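/- Let $\Omega$ be a finite set of cardinality $d \ge 3$ and let $T$ be a $d$-regular tree whose (non-oriented) edges are colored by a map $c$ with values in $\Omega$ such that, for every vertex $v$, the map $c$ restricts to a bijection $c_v$ from the set $E(v)$ of edges containing $v$ onto $\Omega$. For $g \in \mathrm{Aut}(T)$ and a vertex $v$, let $\sigma(g,v) = c_{gv} \circ g_v \circ c_v^{-1} \in \mathrm{Sym}(\Omega)$, where $g_v : E(v) \to E(gv)$ is induced by $g$. For $F \le \mathrm{Sym}(\Omega)$, let $\hat F$ be the group of permutations of $\Omega$ stabilizing every $F$-orbit. For $F \le F' \le \hat F$, let $G(F,F')$ be the group of all $g \in \mathrm{Aut}(T)$ such that $\sigma(g,v) \in F'$ for all vertices $v$ and $\sigma(g,v) \in F$ for all but finitely many $v$. For a subgroup $H \le \mathrm{Aut}(T)$, let $H^\star$ be the subgroup of the elements of $H$ that preserve each of the two blocks of the natural bipartition of the vertex set (two vertices are in the same block if their distance is even). For an edge $e$, let $H_e$ be the subgroup of the elements of $H$ that fix both vertices of $e$. Let $N(F,F')$ be the subgroup of $\mathrm{Aut}(T)$ generated by the derived subgroups $[G(F,F')_e, G(F,F')_e]$,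 where $e$ ranges over all edges of $T$. (1) Let $F \le F'' \le F' \le \hat F$ be permutation groups of $\Omega$ such that $F''$ has index two in $F'$ and the group $G(F,F'')^\star$ is simple. Then $N(F,F')$ is a simple subgroup of index eight in $G(F,F')$. (2) Let $F \le F'$ be permutation groups of $\Omega$ such that $F$ has index two in $F'$, and $F$ is transitive and generated by its point stabilizers. Let $\{v_0,v_1\}$ be an edge of $T$. For $i \in \{0,1\}$, let $G_i(F,F')$ be the subgroup of those $g \in G(F,F')^\star$ for which the number of vertices $v$ at even distance from $v_i$ with $\sigma(g,v) \notin F$ is even. Then $G_0(F,F') \cap G_1(F,F')$ is a simple subgroup of index eight in $G(F,F')$. In particular, $G(F,F')$ has a subgroup of index eight that is simple. -/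

import Mathlib

universe u w

/-- A legal coloring of the (non-oriented) edges of a graph `T` by the set `Ω`: at every vertex `v`,
the map sending a neighbour `x` of `v` to the color of the edge `{v, x}` is a bijection onto `Ω`.
(The edges containing `v` are indexed by the neighbours of `v`.)  In particular `T` is regular of
degree the cardinality of `Ω`. -/
structure LegalColoring {V : Type u} (T : SimpleGraph V) (Ω : Type w) where
  /-- the color of an edge -/
  color : T.edgeSet → Ω
  bijective_star : ∀ v : V,
    Function.Bijective (fun x : T.neighborSet v => color ⟨s(v, (x : V)), x.2⟩)

namespace LegalColoring

/-- The bijection `c_v` from the set of edges containing `v` (indexed by the neighbours of `v`)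
to the set of colors. -/
noncomputable def star {V : Type u} {T : SimpleGraph V} {Ω : Type w}
    (c : LegalColoring T Ω) (v : V) : T.neighborSet v ≃ Ω :=
  Equiv.ofBijective _ (c.bijective_star v)

/-- The local permutation `σ(g, v) = c_{g v} ∘ g_v ∘ c_v⁻¹` of the automorphism `g` at `v`. -/
noncomputable def localPerm {V : Type u} {T : SimpleGraph V} {Ω : Type w}
    (c : LegalColoring T Ω) (g : T ≃g T) (v : V) : Equiv.Perm Ω :=
  (c.star v).symm.trans ((g.mapNeighborSet v).trans (c.star (g v)))

theorem localPerm_mul {V : Type u} {T : SimpleGraph V} {Ω : Type w}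
    (c : LegalColoring T Ω) (g h : T ≃g T) (v : V) :
    c.localPerm (g * h) v = c.localPerm g (h v) * c.localPerm h v := by
  ext a
  simp only [localPerm, Equiv.trans_apply, Equiv.Perm.mul_apply, Equiv.symm_apply_apply]
  rfl

theorem localPerm_one {V : Type u} {T : SimpleGraph V} {Ω : Type w}
    (c : LegalColoring T Ω) (v : V) : c.localPerm 1 v = 1 := by
  ext a
  exact (c.star v).apply_symm_apply a

theorem localPerm_inv {V : Type u} {T : SimpleGraph V} {Ω : Type w}
    (c : LegalColoring T Ω) (g : T ≃g T) (v : V) :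
    c.localPerm g⁻¹ v = (c.localPerm g (g⁻¹ v))⁻¹ := by
  have h := c.localPerm_mul g g⁻¹ v
  rw [mul_inv_cancel, localPerm_one] at h
  exact (inv_eq_of_mul_eq_one_right h.symm).symm

/-- The set of vertices at which the local permutation of `g` is not in `F`. -/
def singularities {V : Type u} {T : SimpleGraph V} {Ω : Type w}
    (c : LegalColoring T Ω) (F : Subgroup (Equiv.Perm Ω)) (g : T ≃g T) : Set V :=
  {v | c.localPerm g v ∉ F}

theorem singularities_mul_subset {V : Type u} {T : SimpleGraph V} {Ω : Type w}
    (c : LegalColoring T Ω) (F : Subgroup (Equiv.Perm Ω)) (g h : T ≃g T) :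
    c.singularities F (g * h) ⊆ c.singularities F h ∪ h ⁻¹' c.singularities F g := by
  intro v hv
  by_contra hn
  simp only [singularities, Set.mem_union, Set.mem_ofPred_eq, Set.mem_preimage, not_or,
    not_not] at hn hv
  exact hv (by rw [localPerm_mul]; exact F.mul_mem hn.2 hn.1)

theorem singularities_inv {V : Type u} {T : SimpleGraph V} {Ω : Type w}
    (c : LegalColoring T Ω) (F : Subgroup (Equiv.Perm Ω)) (g : T ≃g T) :
    c.singularities F g⁻¹ = (g⁻¹ : T ≃g T) ⁻¹' c.singularities F g := by
  ext v
  simp [singularities, localPerm_inv]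

/-- The group `U(F)` of automorphisms all of whose local permutations are in `F`. -/
def universalGroup {V : Type u} {T : SimpleGraph V} {Ω : Type w}
    (c : LegalColoring T Ω) (F : Subgroup (Equiv.Perm Ω)) : Subgroup (T ≃g T) where
  carrier := {g | ∀ v, c.localPerm g v ∈ F}
  one_mem' v := by rw [localPerm_one]; exact F.one_mem
  mul_mem' hg hh v := by rw [localPerm_mul]; exact F.mul_mem (hg _) (hh v)
  inv_mem' hg v := by rw [localPerm_inv]; exact F.inv_mem (hg _)

/-- The group `G(F)` of automorphisms all but finitely many of whose local permutations
are in `F`. -/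
def almostGroup {V : Type u} {T : SimpleGraph V} {Ω : Type w}
    (c : LegalColoring T Ω) (F : Subgroup (Equiv.Perm Ω)) : Subgroup (T ≃g T) where
  carrier := {g | (c.singularities F g).Finite}
  one_mem' := by simp [singularities, localPerm_one, F.one_mem]
  mul_mem' {g h} hg hh :=
    (hh.union (hg.preimage h.injective.injOn)).subset (c.singularities_mul_subset F g h)
  inv_mem' {g} hg := by
    rw [Set.mem_ofPred_eq, singularities_inv]
    exact Set.Finite.preimage (g⁻¹ : T ≃g T).injective.injOn hg

/-- The group `G(F, F') = G(F) ∩ U(F')`. -/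
def G {V : Type u} {T : SimpleGraph V} {Ω : Type w}
    (c : LegalColoring T Ω) (F F' : Subgroup (Equiv.Perm Ω)) : Subgroup (T ≃g T) :=
  c.almostGroup F ⊓ c.universalGroup F'

end LegalColoring

/-- The set of vertices at even distance from `v`, that is, the block containing `v` of the
natural bipartition of the vertex set of a tree. -/
def evenBlock {V : Type u} (T : SimpleGraph V) (v : V) : Set V :=
  {x | Even (T.dist v x)}

/-- The type-preserving subgroup `H^⋆` of a group `H` of automorphisms: the elements of `H`
that map each block of the natural bipartition to itself. -/
def typePreserving {V : Type u} {T : SimpleGraph V} (H : Subgroup (T ≃g T)) :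
    Subgroup (T ≃g T) where
  carrier := {g | g ∈ H ∧ ∀ v x, g x ∈ evenBlock T v ↔ x ∈ evenBlock T v}
  one_mem' := ⟨H.one_mem, fun _ _ => Iff.rfl⟩
  mul_mem' {g h} hg hh := ⟨H.mul_mem hg.1 hh.1, fun v x => (hg.2 v (h x)).trans (hh.2 v x)⟩
  inv_mem' {g} hg := ⟨H.inv_mem hg.1, fun v x => by
    have h := hg.2 v (g⁻¹ x)
    rw [RelIso.apply_inv_self] at h
    exact h.symm⟩

/-- The subgroup `H_e` of the elements of `H` that fix both vertices of the edge `e`. -/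
def edgeFixator {V : Type u} {T : SimpleGraph V} (H : Subgroup (T ≃g T)) (e : T.edgeSet) :
    Subgroup (T ≃g T) where
  carrier := {g | g ∈ H ∧ ∀ x ∈ (e : Sym2 V), g x = x}
  one_mem' := ⟨H.one_mem, fun _ _ => rfl⟩
  mul_mem' {g h} hg hh := ⟨H.mul_mem hg.1 hh.1, fun x hx => by
    rw [RelIso.mul_apply, hh.2 x hx, hg.2 x hx]⟩
  inv_mem' {g} hg := ⟨H.inv_mem hg.1, fun x hx => by
    have h := RelIso.inv_apply_self (e := g) x
    rwa [hg.2 x hx] at h⟩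

namespace LegalColoring

/-- The group `N(F, F')` generated by the derived subgroups `[G(F, F')_e, G(F, F')_e]` of the
pointwise stabilizers of edges. -/
def N {V : Type u} {T : SimpleGraph V} {Ω : Type w}
    (c : LegalColoring T Ω) (F F' : Subgroup (Equiv.Perm Ω)) : Subgroup (T ≃g T) :=
  ⨆ e : T.edgeSet, ⁅edgeFixator (c.G F F') e, edgeFixator (c.G F F') e⁆

/-- The singularities of `g` in the block of the vertex `v`. For an edge `{v₀, v₁}`, this is
`S_i(g)` when `v = v_i`. -/
def singularitiesIn {V : Type u} {T : SimpleGraph V} {Ω : Type w}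
    (c : LegalColoring T Ω) (F : Subgroup (Equiv.Perm Ω)) (v : V) (g : T ≃g T) : Set V :=
  c.singularities F g ∩ evenBlock T v

theorem singularitiesIn_mul {V : Type u} {T : SimpleGraph V} {Ω : Type w}
    (c : LegalColoring T Ω) {F F' : Subgroup (Equiv.Perm Ω)} (hF : F.relIndex F' = 2) (v : V)
    {g h : T ≃g T} (hg : g ∈ typePreserving (c.G F F')) (hh : h ∈ typePreserving (c.G F F')) :
    c.singularitiesIn F v (g * h) =
      symmDiff (c.singularitiesIn F v h) (h ⁻¹' c.singularitiesIn F v g) := by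
  ext x
  have key : c.localPerm g (h x) * c.localPerm h x ∈ F ↔
      (c.localPerm g (h x) ∈ F ↔ c.localPerm h x ∈ F) := by
    have := Subgroup.mul_mem_iff_of_index_two (H := F.subgroupOf F') hF
      (a := ⟨_, hg.1.2 (h x)⟩) (b := ⟨_, hh.1.2 x⟩)
    simpa only [Subgroup.mem_subgroupOf, Subgroup.coe_mul] using this
  have hb := hh.2 v x
  simp only [singularitiesIn, singularities, Set.mem_inter_iff, Set.mem_ofPred_eq,
    Set.mem_symmDiff, Set.mem_preimage, localPerm_mul, key, hb]
  tauto

theorem even_ncard_symmDiff {V : Type u} {A B : Set V} (hA : A.Finite) (hB : B.Finite)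
    (hA2 : Even A.ncard) (hB2 : Even B.ncard) : Even (symmDiff A B).ncard := by
  have h1 := Set.ncard_inter_add_ncard_sdiff_eq_ncard A B hA
  have h2 := Set.ncard_inter_add_ncard_sdiff_eq_ncard B A hB
  have h3 : (symmDiff A B).ncard = (A \ B).ncard + (B \ A).ncard :=
    Set.ncard_union_eq disjoint_sdiff_sdiff hA.sdiff hB.sdiff
  rw [Set.inter_comm] at h2
  rw [Nat.even_iff] at *
  omega

theorem preimage_ncard {V : Type u} {T : SimpleGraph V} (h : T ≃g T) (A : Set V) :
    (h ⁻¹' A).ncard = A.ncard :=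
  Set.ncard_preimage_of_injective_subset_range h.injective (by simp [h.surjective.range_eq])

/-- For `F` of index two in `F'`: the group of the elements of `G(F, F')^⋆` with an even number
of singularities in the block of the vertex `v`. For an edge `{v₀, v₁}`, this is `G_i(F, F')`
when `v = v_i`. -/
def evenGroup {V : Type u} {T : SimpleGraph V} {Ω : Type w}
    (c : LegalColoring T Ω) (F F' : Subgroup (Equiv.Perm Ω)) (hF : F.relIndex F' = 2) (v : V) :
    Subgroup (T ≃g T) where
  carrier := {g | g ∈ typePreserving (c.G F F') ∧ Even (c.singularitiesIn F v g).ncard}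
  one_mem' := ⟨Subgroup.one_mem _, by
    simp [singularitiesIn, singularities, localPerm_one, F.one_mem]⟩
  mul_mem' {g h} hg hh := ⟨Subgroup.mul_mem _ hg.1 hh.1, by
    rw [singularitiesIn_mul c hF v hg.1 hh.1]
    refine even_ncard_symmDiff (hh.1.1.1.subset Set.inter_subset_left) ?_ hh.2 ?_
    · exact (hg.1.1.1.subset Set.inter_subset_left).preimage h.injective.injOn
    · rw [preimage_ncard]; exact hg.2⟩
  inv_mem' {g} hg := ⟨Subgroup.inv_mem _ hg.1, by
    have h : c.singularitiesIn F v g⁻¹ = (g⁻¹ : T ≃g T) ⁻¹' c.singularitiesIn F v g := by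
      ext x
      have hb := (Subgroup.inv_mem _ hg.1).2 v x
      simp only [singularitiesIn, singularities_inv, Set.mem_inter_iff, Set.mem_preimage, hb]
    rw [h, preimage_ncard]; exact hg.2⟩

end LegalColoring

/-- The Young subgroup of the permutations that stabilize each orbit of `F`. -/
def youngSubgroup {Ω : Type w} (F : Subgroup (Equiv.Perm Ω)) : Subgroup (Equiv.Perm Ω) where
  carrier := {s | ∀ a : Ω, s a ∈ MulAction.orbit F a}
  one_mem' a := MulAction.mem_orbit_self a
  mul_mem' {s t} hs ht a := by
    have h := hs (t a)
    rwa [MulAction.orbit_eq_iff.mpr (ht a)] at h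
  inv_mem' {s} hs a := by
    have h := hs (s⁻¹ a)
    rw [← Equiv.Perm.mul_apply, mul_inv_cancel, Equiv.Perm.one_apply] at h
    exact MulAction.mem_orbit_symm.mp h

/-- The subgroup `F⁺` of a permutation group `F` generated by its point stabilizers. -/
def stabilizerGenerated {Ω : Type w} (F : Subgroup (Equiv.Perm Ω)) : Subgroup (Equiv.Perm Ω) :=
  ⨆ a : Ω, F ⊓ MulAction.stabilizer (Equiv.Perm Ω) a

/-! Both statements concern one group M (`evenPart`): the elements of G(F, F')^⋆ having, in each of
the two blocks, an even number of singularities with respect to F''. Statement (2) is the case F'' =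
F, where G(F, F) = U(F).

Index: since F'' has index two in F', being singular behaves like a sign. The singular set of a
product is a symmetric difference, and the parities in the two blocks are homomorphisms on G(F,
F')^⋆. Automorphisms with one singularity at a chosen vertex (`exists_single_singularity`) make them
jointly surjective; together with the type homomorphism this gives 2 · 2 · 2.

Simplicity: let P ≠ 1 be normal in M, and H = G(F, F'')^⋆. The commutator of p in P with a suitable
h in H, supported in a half-tree that p moves off itself and fixing the singularities of p, is a
nontrivial element of P ∩ H, so H ≤ P (`typePreserving_G_le_of_normalized`). The same holds for the
conjugates of P, so P contains every G(F, F')^⋆-conjugate of H. Modulo P, singularities can then be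
removed two at a time (`evenPart_le_of_normalized`). The group N is nontrivial, normalized by G(F,
F'), and inside M because commutators have even parities; hence N = M.

For (2), the simplicity of U(F)^⋆ is Tits' argument: an element supported in a half-tree is a
commutator with an element of any given nontrivial normal subgroup (`exists_eq_commutator`), such
elements generate the edge fixators, and these generate U(F)^⋆. -/

namespace LegalColoring

/-! ### Neighbours indexed by colors -/

variable {V : Type u} {T : SimpleGraph V} {Ω : Type w} (c : LegalColoring T Ω)

/-- The neighbour of `v` joined to `v` by the edge of color `a`. -/
noncomputable def nb (v : V) (a : Ω) : V := (c.star v).symm a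

theorem adj_nb (v : V) (a : Ω) : T.Adj v (c.nb v a) := ((c.star v).symm a).2

theorem nb_injective (v : V) : Function.Injective (c.nb v) := fun _ _ h =>
  (c.star v).symm.injective (Subtype.ext h)

theorem exists_nb_eq {v x : V} (h : T.Adj v x) : ∃ a, c.nb v a = x :=
  ⟨c.star v ⟨x, h⟩, by simp [nb]⟩

theorem star_nb (v : V) (a : Ω) (h : T.Adj v (c.nb v a)) : c.star v ⟨c.nb v a, h⟩ = a :=
  (c.star v).apply_symm_apply a

theorem star_comm {v x : V} (h : T.Adj v x) : c.star v ⟨x, h⟩ = c.star x ⟨v, h.symm⟩ := by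
  change c.color _ = c.color _
  congr 2
  exact Sym2.eq_swap

theorem nb_nb (v : V) (a : Ω) : c.nb (c.nb v a) a = v := by
  have h := c.star_comm (c.adj_nb v a)
  rw [star_nb] at h
  conv_lhs => rw [nb]; arg 1; arg 2; rw [h]
  simp

theorem map_nb (g : T ≃g T) (v : V) (a : Ω) : g (c.nb v a) = c.nb (g v) (c.localPerm g v a) := by
  simp [nb, localPerm]

theorem localPerm_eq_of_map_nb {g : T ≃g T} {v : V} {s : Ω → Ω}
    (h : ∀ a, g (c.nb v a) = c.nb (g v) (s a)) (a : Ω) : c.localPerm g v a = s a :=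
  c.nb_injective (g v) ((c.map_nb g v a).symm.trans (h a))

/-- Two adjacent vertices see the color of the edge between them moved in the same way. -/
theorem localPerm_nb (g : T ≃g T) (v : V) (a : Ω) :
    c.localPerm g (c.nb v a) a = c.localPerm g v a := by
  apply c.nb_injective (g (c.nb v a))
  rw [← map_nb, nb_nb]
  conv_rhs => rw [map_nb, nb_nb]

theorem localPerm_congr {g h : T ≃g T} {v : V} (h0 : g v = h v)
    (hnb : ∀ a, g (c.nb v a) = h (c.nb v a)) : c.localPerm g v = c.localPerm h v := by
  ext a
  refine c.localPerm_eq_of_map_nb (s := c.localPerm h v) (fun b => ?_) a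
  rw [hnb, map_nb, h0]

theorem nb_induction (hT : T.IsTree) {P : V → Prop} (r : V) (h0 : P r)
    (h : ∀ x a, P x → P (c.nb x a)) (x : V) : P x := by
  obtain ⟨p⟩ := hT.connected r x
  induction p with
  | nil => exact h0
  | cons hadj p ih =>
    obtain ⟨a, rfl⟩ := c.exists_nb_eq hadj
    exact ih (h _ a h0)

/-! ### Half-trees -/

/-- The component containing `nb v a` of the complement of the edge of color `a` at `v`. -/
def half (v : V) (a : Ω) : Set V :=
  {x | (T.deleteEdges {s(v, c.nb v a)}).Reachable (c.nb v a) x}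

theorem nb_mem_half (v : V) (a : Ω) : c.nb v a ∈ c.half v a := SimpleGraph.Reachable.refl _

/-- Inside a half-tree the only forbidden step is the one back across its boundary edge. -/
theorem half_induction {v : V} {a : Ω} {P : V → Prop} (h0 : P (c.nb v a))
    (h : ∀ x b, x ∈ c.half v a → P x → ¬ (x = c.nb v a ∧ b = a) → P (c.nb x b))
    {x : V} (hx : x ∈ c.half v a) : P x := by
  obtain ⟨p⟩ := hx
  suffices H : ∀ y z (q : (T.deleteEdges {s(v, c.nb v a)}).Walk y z), y ∈ c.half v a → P y → P z from
    H _ _ p (c.nb_mem_half v a) h0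
  intro y z q
  induction q with
  | nil => exact fun _ h => h
  | @cons y y' z hadj p ih =>
    intro hy hPy
    have hadj' := hadj
    rw [SimpleGraph.deleteEdges_adj] at hadj'
    obtain ⟨b, rfl⟩ := c.exists_nb_eq hadj'.1
    refine ih (hy.trans hadj.reachable) (h y b hy hPy ?_)
    rintro ⟨rfl, rfl⟩
    apply hadj'.2
    rw [nb_nb]
    exact Sym2.eq_swap

theorem notMem_half_self (hT : T.IsTree) (v : V) (a : Ω) : v ∉ c.half v a := fun h => by
  have := SimpleGraph.isAcyclic_iff_forall_isBridge.1 hT.isAcyclic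
    ((SimpleGraph.mem_edgeSet T).2 (c.adj_nb v a))
  rw [SimpleGraph.isBridge_iff] at this
  exact this h.symm

theorem nb_mem_half_of_mem (hT : T.IsTree) {v : V} {a : Ω} {x : V} {b : Ω} (hx : x ∈ c.half v a)
    (hne : ¬ (x = c.nb v a ∧ b = a)) : c.nb x b ∈ c.half v a := by
  refine SimpleGraph.Reachable.trans hx (SimpleGraph.Adj.reachable ?_)
  rw [SimpleGraph.deleteEdges_adj]
  refine ⟨c.adj_nb x b, fun h => ?_⟩
  rw [Set.mem_singleton_iff, Sym2.eq_iff] at h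
  rcases h with ⟨rfl, _⟩ | ⟨rfl, h2⟩
  · exact c.notMem_half_self hT _ _ hx
  · refine hne ⟨rfl, c.nb_injective _ (h2.trans (c.nb_nb v a).symm)⟩

theorem half_nb_eq_compl (hT : T.IsTree) (v : V) (a : Ω) : c.half (c.nb v a) a = (c.half v a)ᶜ := by
  have h1 : ∀ x, x ∈ c.half v a ∨ x ∈ c.half (c.nb v a) a := by
    refine c.nb_induction hT v (Or.inr ?_) ?_
    · have := c.nb_mem_half (c.nb v a) a
      rwa [nb_nb] at this
    · intro x b hx
      rcases hx with hx | hx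
      · by_cases h : x = c.nb v a ∧ b = a
        · rw [h.1, h.2]; exact Or.inr (c.nb_mem_half _ _)
        · exact Or.inl (c.nb_mem_half_of_mem hT hx h)
      · by_cases h : x = c.nb (c.nb v a) a ∧ b = a
        · rw [h.1, h.2, nb_nb]; exact Or.inl (c.nb_mem_half _ _)
        · exact Or.inr (c.nb_mem_half_of_mem hT hx h)
  ext x
  rw [Set.mem_compl_iff]
  refine ⟨fun hx => ?_, fun h => (h1 x).resolve_left h⟩
  refine c.half_induction (P := fun x => x ∉ c.half v a) ?_ ?_ hx
  · rw [nb_nb]; exact c.notMem_half_self hT v a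
  · intro y b hy hy' hne hyb
    rw [nb_nb] at hne
    have := c.nb_mem_half_of_mem hT (b := b) hyb
    rw [nb_nb] at this
    refine hy' (this ?_)
    rintro ⟨h, rfl⟩
    apply hne
    refine ⟨?_, rfl⟩
    rw [← c.nb_nb v b, ← h, nb_nb]

theorem mem_half_nb (hT : T.IsTree) {v x : V} {a : Ω} :
    x ∈ c.half (c.nb v a) a ↔ x ∉ c.half v a := by rw [half_nb_eq_compl c hT]; rfl

theorem self_mem_half_nb (v : V) (a : Ω) : v ∈ c.half (c.nb v a) a := by
  have := c.nb_mem_half (c.nb v a) a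
  rwa [nb_nb] at this

theorem exists_mem_half (hT : T.IsTree) {v x : V} (h : x ≠ v) : ∃ a, x ∈ c.half v a := by
  revert h
  refine c.nb_induction hT (P := fun x => x ≠ v → ∃ a, x ∈ c.half v a) v (by simp) ?_ x
  intro x b ih hne
  by_cases hx : x = v
  · exact ⟨b, hx ▸ c.nb_mem_half _ _⟩
  · obtain ⟨a, ha⟩ := ih hx
    refine ⟨a, c.nb_mem_half_of_mem hT ha ?_⟩
    rintro ⟨rfl, rfl⟩
    exact hne (c.nb_nb _ _)

theorem half_subset_half_nb (hT : T.IsTree) (v : V) {a b : Ω} (hab : a ≠ b) :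
    c.half v b ⊆ c.half (c.nb v a) a := by
  intro x hx
  refine c.half_induction (P := fun x => x ∈ c.half (c.nb v a) a) ?_ ?_ hx
  · refine c.nb_mem_half_of_mem hT (c.self_mem_half_nb v a) fun h => hab h.2.symm
  · intro y d hy hy' hne
    refine c.nb_mem_half_of_mem hT hy' ?_
    rintro ⟨rfl, rfl⟩
    rw [nb_nb] at hy
    exact c.notMem_half_self hT _ _ hy

theorem disjoint_half (hT : T.IsTree) (v : V) {a b : Ω} (hab : a ≠ b) :
    Disjoint (c.half v a) (c.half v b) :=
  Set.disjoint_left.2 fun _ ha hb => (c.mem_half_nb hT).1 (c.half_subset_half_nb hT v hab hb) ha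

theorem half_nb_subset_half (hT : T.IsTree) (v : V) {a b : Ω} (hab : a ≠ b) :
    c.half (c.nb v a) b ⊆ c.half v a := by
  have := c.half_subset_half_nb hT (c.nb v a) hab
  rwa [nb_nb] at this

/-- A walk inside the first half-tree could enter the second one only through `y`, which it never
meets. -/
theorem disjoint_half_of_notMem (hT : T.IsTree) {x y : V} {a b : Ω} (hne : x ≠ y)
    (h1 : y ∉ c.half x a) (h2 : x ∉ c.half y b) : Disjoint (c.half x a) (c.half y b) := by
  refine Set.disjoint_left.2 fun z hz => ?_
  rw [← c.mem_half_nb hT] at h2 ⊢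
  refine c.half_induction (P := fun z => z ∈ c.half (c.nb y b) b) ?_ ?_ hz
  · refine c.nb_mem_half_of_mem hT h2 fun h => hne ?_
    rw [h.1, nb_nb]
  · intro w d hw hw' _
    refine c.nb_mem_half_of_mem hT hw' fun h => h1 ?_
    rw [nb_nb] at h
    exact h.1 ▸ hw

theorem map_mem_half (hT : T.IsTree) (g : T ≃g T) {v x : V} {a : Ω} :
    g x ∈ c.half (g v) (c.localPerm g v a) ↔ x ∈ c.half v a := by
  have key : ∀ (v : V) (a : Ω), x ∈ c.half v a → g x ∈ c.half (g v) (c.localPerm g v a) := by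
    intro v a hx
    refine c.half_induction (P := fun x => g x ∈ c.half (g v) (c.localPerm g v a)) ?_ ?_ hx
    · rw [map_nb]; exact c.nb_mem_half _ _
    · intro y b hy hy' hne
      rw [map_nb]
      refine c.nb_mem_half_of_mem hT hy' ?_
      rintro ⟨h1, h2⟩
      rw [← map_nb] at h1
      have h1 := g.injective h1
      subst h1
      rw [← c.localPerm_nb g v a] at h2
      exact hne ⟨rfl, (c.localPerm g _).injective h2⟩
  refine ⟨fun h => ?_, key v a⟩
  by_contra hx
  rw [← c.mem_half_nb hT] at hx
  have := key _ _ hx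
  rw [localPerm_nb, map_nb, c.mem_half_nb hT] at this
  exact this h

/-! ### Lifting along paths -/

/-- A vertex map from a tree can be prescribed by its value at one vertex and its behavior along
the edges. -/
theorem exists_lift (hT : T.IsTree) {X : Type*} (τ : V → Ω → X → X)
    (hτ : ∀ v a x, τ (c.nb v a) a (τ v a x) = x) (r : V) (x₀ : X) :
    ∃ f : V → X, f r = x₀ ∧ ∀ v a, f (c.nb v a) = τ v a (f v) := by
  choose p hp using fun v => (hT.existsUnique_path r v).exists
  let F : ∀ {v w : V}, T.Walk v w → X := fun q =>
    q.darts.foldl (fun x d => τ d.fst (c.star d.fst ⟨d.snd, d.adj⟩) x) x₀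
  have hF : ∀ {v w : V} (h : T.Adj v w), w ∉ (p v).support →
      F (p w) = τ v (c.star v ⟨w, h⟩) (F (p v)) := by
    intro v w h hw
    have : p w = (p v).concat h :=
      (hT.existsUnique_path r w).unique (hp w) ((hp v).concat hw h)
    simp [F, this, SimpleGraph.Walk.darts_concat]
  refine ⟨fun v => F (p v), ?_, fun v a => ?_⟩
  · have : p r = .nil := (hT.existsUnique_path r r).unique (hp r) .nil
    simp [F, this]
  · have h := c.adj_nb v a
    by_cases hw : c.nb v a ∈ (p v).support
    · have hv := hT.isAcyclic.ne_mem_support_of_support_of_adj_of_isPath (hp v) (hp _) h hw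
      have := hF h.symm hv
      dsimp only
      rw [this, ← star_comm c h, star_nb]
      have := hτ (c.nb v a) a (F (p (c.nb v a)))
      rw [nb_nb] at this
      exact this.symm
    · dsimp only
      rw [hF h hw, star_nb]

/-- Automorphisms with prescribed local permutations. -/
theorem exists_localPerm_eq (hT : T.IsTree) (s : V → Equiv.Perm Ω)
    (hs : ∀ v a, s (c.nb v a) a = s v a) (r r' : V) :
    ∃ g : T ≃g T, g r = r' ∧ ∀ v, c.localPerm g v = s v := by
  obtain ⟨f, hf0, hf⟩ := c.exists_lift hT (fun v a x => c.nb x (s v a))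
    (fun v a x => by rw [hs, nb_nb]) r r'
  -- The inverse map is a lift too: the step of color `b` in the image is pulled back by the local
  -- permutation at the current preimage.
  obtain ⟨k, hk0, hk⟩ := c.exists_lift hT (fun _ b x => c.nb x ((s x)⁻¹ b))
    (fun _ b x => by
      have : (s (c.nb x ((s x)⁻¹ b)))⁻¹ b = (s x)⁻¹ b := by
        rw [Equiv.Perm.inv_eq_iff_eq, hs]; simp
      rw [this, nb_nb]) r' r
  have hfk : ∀ y, f (k y) = y := c.nb_induction hT r' (by rw [hk0, hf0]) fun y b h => by
    rw [hk, hf, h]; simp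
  have hkf : ∀ v, k (f v) = v := c.nb_induction hT r (by rw [hf0, hk0]) fun v a h => by
    rw [hf, hk, h]; simp
  have hfadj : ∀ {v w : V}, T.Adj v w → T.Adj (f v) (f w) := fun h => by
    obtain ⟨a, rfl⟩ := c.exists_nb_eq h
    rw [hf]; exact c.adj_nb _ _
  have hkadj : ∀ {v w : V}, T.Adj v w → T.Adj (k v) (k w) := fun h => by
    obtain ⟨a, rfl⟩ := c.exists_nb_eq h
    rw [hk]; exact c.adj_nb _ _
  let g : T ≃g T := ⟨⟨f, k, hkf, hfk⟩, fun {v w} =>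
    ⟨fun h => by have := hkadj h; simpa [hkf] using this, hfadj⟩⟩
  exact ⟨g, hf0, fun v => Equiv.ext fun a => c.localPerm_eq_of_map_nb (hf v) a⟩

end LegalColoring

theorem exists_ne_and_ne_of_three_le_card {Ω : Type w} [Finite Ω] (hΩ : 3 ≤ Nat.card Ω) (a b : Ω) :
    ∃ e, e ≠ a ∧ e ≠ b := by
  classical
  have := Fintype.ofFinite Ω
  rw [Nat.card_eq_fintype_card] at hΩ
  obtain ⟨e, -, he⟩ := Finset.exists_mem_notMem_of_card_lt_card
    (s := ({a, b} : Finset Ω)) (t := Finset.univ)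
    (lt_of_le_of_lt Finset.card_le_two (by rw [Finset.card_univ]; omega))
  exact ⟨e, by simpa using he⟩

namespace LegalColoring

variable {V : Type u} {T : SimpleGraph V} {Ω : Type w} (c : LegalColoring T Ω)

/-! ### The two blocks of vertices -/

theorem even_dist_nb (hT : T.IsTree) (r x : V) (a : Ω) :
    Even (T.dist r (c.nb x a)) ↔ ¬ Even (T.dist r x) := by
  rcases hT.dist_eq_dist_add_one_of_adj r (c.adj_nb x a) with h | h <;> rw [h] <;>
    simp [Nat.even_add_one]

theorem even_dist_iff (c : LegalColoring T Ω) (hT : T.IsTree) (r x y : V) :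
    Even (T.dist x y) ↔ (Even (T.dist r x) ↔ Even (T.dist r y)) := by
  refine c.nb_induction hT
    (P := fun y => Even (T.dist x y) ↔ (Even (T.dist r x) ↔ Even (T.dist r y))) x (by simp) ?_ y
  intro y a ih
  rw [even_dist_nb c hT, even_dist_nb c hT, ih]
  tauto

theorem even_dist_map_iff (c : LegalColoring T Ω) (hT : T.IsTree) {g : T ≃g T} {v : V} (h : Even (T.dist v (g v))) (r x : V) :
    Even (T.dist r (g x)) ↔ Even (T.dist r x) := by
  refine c.nb_induction hT (P := fun x => Even (T.dist r (g x)) ↔ Even (T.dist r x)) v ?_ ?_ x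
  · exact ((c.even_dist_iff hT r _ _).1 h).symm
  · intro x a ih
    rw [map_nb, even_dist_nb c hT, even_dist_nb c hT, ih]

theorem mem_typePreserving_iff (c : LegalColoring T Ω) (hT : T.IsTree) {H : Subgroup (T ≃g T)} {g : T ≃g T} (v : V) :
    g ∈ typePreserving H ↔ g ∈ H ∧ Even (T.dist v (g v)) := by
  refine ⟨fun h => ⟨h.1, (h.2 v v).2 (by simp [evenBlock])⟩, fun h => ⟨h.1, fun r x => ?_⟩⟩
  exact c.even_dist_map_iff hT h.2 r x

theorem mem_typePreserving_of_fixed (c : LegalColoring T Ω) (hT : T.IsTree) {H : Subgroup (T ≃g T)} {g : T ≃g T} {v : V}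
    (hg : g ∈ H) (hv : g v = v) : g ∈ typePreserving H :=
  (c.mem_typePreserving_iff hT v).2 ⟨hg, by rw [hv]; simp⟩

/-! ### Elements with prescribed local action -/

/-- The automorphisms preserving colors act transitively on the vertices. -/
theorem exists_mem_universalGroup_bot (hT : T.IsTree) (v x : V) :
    ∃ g ∈ c.universalGroup ⊥, g v = x := by
  obtain ⟨g, h0, hg⟩ := c.exists_localPerm_eq hT (fun _ => 1) (fun _ _ => rfl) v x
  exact ⟨g, fun v => by rw [hg]; exact Subgroup.one_mem _, h0⟩

variable {c}

theorem localPerm_eq_one_of_mem {g : T ≃g T} (hg : g ∈ c.universalGroup ⊥) (v : V) :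
    c.localPerm g v = 1 := Subgroup.mem_bot.1 (hg v)

theorem map_nb_of_mem_bot {g : T ≃g T} (hg : g ∈ c.universalGroup ⊥) (v : V) (a : Ω) :
    g (c.nb v a) = c.nb (g v) a := by
  rw [map_nb, localPerm_eq_one_of_mem hg]; rfl

theorem universalGroup_mono {F F' : Subgroup (Equiv.Perm Ω)} (h : F ≤ F') :
    c.universalGroup F ≤ c.universalGroup F' := fun _ hg v => h (hg v)

theorem almostGroup_mono {F F' : Subgroup (Equiv.Perm Ω)} (h : F ≤ F') :
    c.almostGroup F ≤ c.almostGroup F' := fun _ hg =>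
  Set.Finite.subset hg fun _ hv hF => hv (h hF)

theorem universalGroup_le_almostGroup (F : Subgroup (Equiv.Perm Ω)) :
    c.universalGroup F ≤ c.almostGroup F := fun g hg => by
  have : c.singularities F g = ∅ := Set.eq_empty_iff_forall_notMem.2 fun v hv => hv (hg v)
  change (c.singularities F g).Finite
  rw [this]; exact Set.finite_empty

theorem universalGroup_le_G {F F' : Subgroup (Equiv.Perm Ω)} (h : F ≤ F') :
    c.universalGroup F ≤ c.G F F' :=
  le_inf (universalGroup_le_almostGroup F) (universalGroup_mono h)

theorem universalGroup_bot_le_G {F F' : Subgroup (Equiv.Perm Ω)} :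
    c.universalGroup ⊥ ≤ c.G F F' :=
  le_inf ((universalGroup_le_almostGroup _).trans (almostGroup_mono bot_le))
    (universalGroup_mono bot_le)

theorem typePreserving_mono {H K : Subgroup (T ≃g T)} (h : H ≤ K) :
    typePreserving H ≤ typePreserving K := fun _ hg => ⟨h hg.1, hg.2⟩

variable (c)

/-- Prescribe `s` at `v` and, on each branch `half v a`, a constant element of `F` that agrees with
`s` at `a`. It exists because `s` preserves the orbits of `F`, and it may be taken trivial when `s`
fixes `a`. -/
theorem exists_singular (hT : T.IsTree) (F : Subgroup (Equiv.Perm Ω)) (v : V) {s : Equiv.Perm Ω}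
    (hs : s ∈ youngSubgroup F) :
    ∃ g : T ≃g T, g v = v ∧ c.localPerm g v = s ∧ (∀ x, x ≠ v → c.localPerm g x ∈ F) ∧
      ∀ a, s a = a → ∀ x ∈ c.half v a, g x = x := by
  classical
  have hf : ∀ a, ∃ f : Equiv.Perm Ω, f ∈ F ∧ f a = s a ∧ (s a = a → f = 1) := fun a => by
    by_cases ha : s a = a
    · exact ⟨1, F.one_mem, ha.symm, fun _ => rfl⟩
    · obtain ⟨f, hf⟩ := hs a
      exact ⟨f, f.2, hf, fun h => absurd h ha⟩
  choose f hfF hfa hf1 using hf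
  have hbr : ∀ x, ∃ t : Equiv.Perm Ω, (x = v → t = s) ∧ ∀ a, x ∈ c.half v a → t = f a := fun x => by
    by_cases hx : x = v
    · exact ⟨s, fun _ => rfl, fun a ha => absurd (hx ▸ ha) (c.notMem_half_self hT v a)⟩
    · obtain ⟨a, ha⟩ := c.exists_mem_half hT hx
      refine ⟨f a, fun h => absurd h hx, fun b hb => ?_⟩
      by_contra hne
      have hab : a ≠ b := fun h => hne (h ▸ rfl)
      exact Set.disjoint_left.1 (c.disjoint_half hT v hab) ha hb
  choose t htv ht using hbr
  obtain ⟨g, hgv, hg⟩ := c.exists_localPerm_eq hT t (fun x a => by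
    by_cases hx : x = v
    · rw [hx, ht _ a (c.nb_mem_half v a), htv v rfl, hfa]
    · by_cases hy : c.nb x a = v
      · have hxa : x = c.nb v a := by rw [← hy, nb_nb]
        rw [hy, htv v rfl, hxa, ht _ a (c.nb_mem_half v a), hfa]
      · obtain ⟨b, hb⟩ := c.exists_mem_half hT hx
        rw [ht x b hb, ht (c.nb x a) b (c.nb_mem_half_of_mem hT hb ?_)]
        rintro ⟨rfl, rfl⟩
        exact hy (c.nb_nb _ _)) v v
  refine ⟨g, hgv, by rw [hg, htv v rfl], fun x hx => ?_, fun a ha x hx => ?_⟩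
  · obtain ⟨a, hxa⟩ := c.exists_mem_half hT hx
    rw [hg, ht x a hxa]; exact hfF a
  · refine c.half_induction (P := fun x => g x = x) ?_ ?_ hx
    · rw [map_nb, hgv, hg, htv v rfl, ha]
    · intro y b hy hy' _
      rw [map_nb, hy', hg, ht y a hy, hf1 a ha]; rfl

/-! ### Half-trees inside half-trees -/

section Finite

variable [Finite Ω]

/-- Each half-tree contains two disjoint half-trees, so points can be avoided one at a time. -/
theorem exists_half_disjoint (hΩ : 3 ≤ Nat.card Ω) (hT : T.IsTree) (x : V) (a : Ω) {S : Set V}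
    (hS : S.Finite) : ∃ y b, c.half y b ⊆ c.half x a ∧ Disjoint (c.half y b) S := by
  induction S, hS using Set.Finite.induction_on with
  | empty => exact ⟨x, a, subset_rfl, Set.disjoint_empty _⟩
  | @insert s S _ _ ih =>
    obtain ⟨y, b, hyb, hd⟩ := ih
    obtain ⟨e, heb, -⟩ := exists_ne_and_ne_of_three_le_card hΩ b b
    obtain ⟨e', he'b, he'e⟩ := exists_ne_and_ne_of_three_le_card hΩ b e
    have h1 : c.half (c.nb y b) e ⊆ c.half y b := c.half_nb_subset_half hT y heb.symm
    have h2 : c.half (c.nb y b) e' ⊆ c.half y b := c.half_nb_subset_half hT y he'b.symm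
    by_cases hs : s ∈ c.half (c.nb y b) e
    · refine ⟨_, e', h2.trans hyb, ?_⟩
      rw [Set.disjoint_insert_right]
      exact ⟨Set.disjoint_left.1 (c.disjoint_half hT _ he'e.symm) hs, hd.mono_left h2⟩
    · refine ⟨_, e, h1.trans hyb, ?_⟩
      rw [Set.disjoint_insert_right]
      exact ⟨hs, hd.mono_left h1⟩

/-- Each half-tree contains half-trees avoiding a given finite set, with boundary edge of given
color and direction. -/
theorem exists_half_subset (hΩ : 3 ≤ Nat.card Ω) (hT : T.IsTree) (x : V) (a : Ω) {S : Set V}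
    (hS : S.Finite) (r : V) (b : Ω) :
    ∃ v, c.half v b ⊆ c.half x a ∧ Disjoint (c.half v b) S ∧ Even (T.dist r v) := by
  obtain ⟨y, d, hyd, hd⟩ := c.exists_half_disjoint hΩ hT x a hS
  obtain ⟨e, hed, heb⟩ := exists_ne_and_ne_of_three_le_card hΩ d b
  obtain ⟨e', he'e, he'b⟩ := exists_ne_and_ne_of_three_le_card hΩ e b
  have h1 : c.half (c.nb y d) e ⊆ c.half y d := c.half_nb_subset_half hT y hed.symm
  have h2 : c.half (c.nb (c.nb y d) e) b ⊆ c.half (c.nb y d) e := c.half_nb_subset_half hT _ heb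
  have h3 : c.half (c.nb (c.nb y d) e) e' ⊆ c.half (c.nb y d) e :=
    c.half_nb_subset_half hT _ he'e.symm
  have h4 : c.half (c.nb (c.nb (c.nb y d) e) e') b ⊆ c.half (c.nb (c.nb y d) e) e' :=
    c.half_nb_subset_half hT _ he'b
  -- If the parity is wrong, one more step along color `e'` corrects it.
  by_cases hp : Even (T.dist r (c.nb (c.nb y d) e))
  · exact ⟨_, (h2.trans h1).trans hyd, hd.mono_left (h2.trans h1), hp⟩
  · refine ⟨_, ((h4.trans h3).trans h1).trans hyd, hd.mono_left ((h4.trans h3).trans h1), ?_⟩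
    rwa [even_dist_nb c hT]

/-- A nontrivial automorphism maps some half-tree off itself. -/
theorem exists_half_disjoint_image (hΩ : 3 ≤ Nat.card Ω) (hT : T.IsTree) {p : T ≃g T}
    (hp : p ≠ 1) : ∃ x a, ∀ z ∈ c.half x a, p z ∉ c.half x a := by
  obtain ⟨x, hx⟩ : ∃ x, p x ≠ x := by
    by_contra! h
    exact hp (RelIso.ext h)
  obtain ⟨e, he⟩ := c.exists_mem_half hT hx
  obtain ⟨e', he'⟩ := c.exists_mem_half hT hx.symm
  -- The half-tree at `x` must point away from `p x`, and its image at `p x` away from `x`.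
  obtain ⟨a, ha, ha'⟩ := exists_ne_and_ne_of_three_le_card hΩ e ((c.localPerm p x)⁻¹ e')
  refine ⟨x, a, fun z hz => ?_⟩
  rw [← c.map_mem_half hT p] at hz
  refine Set.disjoint_right.1 (c.disjoint_half_of_notMem hT hx.symm ?_ ?_) hz
  · exact Set.disjoint_right.1 (c.disjoint_half hT x ha) he
  · refine Set.disjoint_right.1 (c.disjoint_half hT (p x) (fun h => ha' ?_)) he'
    rw [← h]; simp

end Finite

end LegalColoring

/-! ### Simplicity inside an ambient group, and parities of symmetric differences -/

theorem Subgroup.isSimpleGroup_of_forall_le {A : Type*} [Group A] {M : Subgroup A} (hne : M ≠ ⊥)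
    (h : ∀ P ≤ M, (∀ m ∈ M, ∀ p ∈ P, m * p * m⁻¹ ∈ P) → P ≠ ⊥ → M ≤ P) : IsSimpleGroup M := by
  have : Nontrivial M := (Subgroup.nontrivial_iff_ne_bot M).2 hne
  refine ⟨fun Q hQ => ?_⟩
  by_cases hQb : Q = ⊥
  · exact Or.inl hQb
  refine Or.inr ?_
  have hle : M ≤ Q.map M.subtype := by
    refine h _ (Subgroup.map_subtype_le Q) ?_ ?_
    · rintro m hm _ ⟨q, hq, rfl⟩
      exact ⟨⟨m, hm⟩ * q * ⟨m, hm⟩⁻¹, hQ.conj_mem q hq _, rfl⟩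
    · rwa [Ne, Subgroup.map_eq_bot_iff_of_injective _ M.subtype_injective]
  refine eq_top_iff.2 fun x _ => ?_
  obtain ⟨q, hq, hqx⟩ := hle x.2
  rwa [← Subtype.ext hqx]

theorem Subgroup.le_of_isSimpleGroup {A : Type*} [Group A] {H : Subgroup A} [IsSimpleGroup H]
    {Q : Subgroup A} (hQ : ∀ h ∈ H, ∀ q ∈ Q, h * q * h⁻¹ ∈ Q) {x : A} (hxH : x ∈ H) (hxQ : x ∈ Q)
    (hx : x ≠ 1) : H ≤ Q := by
  have hn : (Q.subgroupOf H).Normal := ⟨fun q hq h => hQ h h.2 q hq⟩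
  rcases IsSimpleGroup.eq_bot_or_eq_top_of_normal _ hn with h | h
  · have hmem : (⟨x, hxH⟩ : H) ∈ Q.subgroupOf H := hxQ
    rw [h, Subgroup.mem_bot] at hmem
    exact absurd (congrArg Subtype.val hmem) hx
  · exact Subgroup.subgroupOf_eq_top.1 h

theorem even_ncard_symmDiff_iff {V : Type u} {A B : Set V} (hA : A.Finite) (hB : B.Finite) :
    Even (symmDiff A B).ncard ↔ (Even A.ncard ↔ Even B.ncard) := by
  have h1 := Set.ncard_inter_add_ncard_sdiff_eq_ncard A B hA
  have h2 := Set.ncard_inter_add_ncard_sdiff_eq_ncard B A hB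
  have h3 : (symmDiff A B).ncard = (A \ B).ncard + (B \ A).ncard :=
    Set.ncard_union_eq disjoint_sdiff_sdiff hA.sdiff hB.sdiff
  rw [Set.inter_comm] at h2
  simp only [Nat.even_iff]
  omega

namespace LegalColoring

variable {V : Type u} {T : SimpleGraph V} {Ω : Type w} (c : LegalColoring T Ω)

theorem mem_G_of_singular {F F' : Subgroup (Equiv.Perm Ω)} (h : F ≤ F') {g : T ≃g T} {v : V}
    (hv : c.localPerm g v ∈ F') (hF : ∀ x, x ≠ v → c.localPerm g x ∈ F) : g ∈ c.G F F' := by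
  refine ⟨(Set.finite_singleton v).subset fun x hx => ?_, fun x => ?_⟩
  · by_contra hne
    exact hx (hF x hne)
  · by_cases hx : x = v
    · exact hx ▸ hv
    · exact h (hF x hx)

/-- A nontrivial permutation with a fixed point yields nontrivial elements supported in any given
half-tree, outside a given finite set. -/
theorem exists_supported_half [Finite Ω] (hΩ : 3 ≤ Nat.card Ω) (hT : T.IsTree)
    {F F'' : Subgroup (Equiv.Perm Ω)} (h1 : F ≤ F'') {t : Equiv.Perm Ω} (ht : t ∈ F'')
    (htY : t ∈ youngSubgroup F) {a : Ω} (hta : t a = a) (ht1 : t ≠ 1) (x : V) (e : Ω) {S : Set V}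
    (hS : S.Finite) :
    ∃ h ∈ c.G F F'', (∀ y, y ∉ c.half x e → h y = y) ∧ (∀ y ∈ S, h y = y) ∧
      ∃ y ∈ c.half x e, h y ≠ y := by
  obtain ⟨b, hb⟩ : ∃ b, t b ≠ b := by
    by_contra! h
    exact ht1 (Equiv.ext h)
  have hab : a ≠ b := fun h => hb (h ▸ hta)
  obtain ⟨v, hv, hvS, -⟩ := c.exists_half_subset hΩ hT x e hS x a
  -- Centered at `nb v a`: since `t` fixes `a`, everything beyond the edge back to `v` is fixed.
  obtain ⟨h, hf, hs, hF, hfix⟩ := c.exists_singular hT F (c.nb v a) htY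
  have hfix' : ∀ y, y ∉ c.half v a → h y = y := fun y hy =>
    hfix a hta y ((c.mem_half_nb hT).2 hy)
  refine ⟨h, c.mem_G_of_singular h1 (hs ▸ ht) hF, fun y hy => hfix' y fun h => hy (hv h),
    fun y hy => hfix' y (Set.disjoint_right.1 hvS hy), c.nb (c.nb v a) b,
    hv (c.half_nb_subset_half hT v hab (c.nb_mem_half _ _)), ?_⟩
  rw [map_nb, hf, hs]
  exact fun h => hb (c.nb_injective _ h)

/-- If `G(F, F'')^⋆` is simple, then `F''` does not act freely. -/
theorem exists_fixed_of_isSimpleGroup [Finite Ω] (hΩ : 3 ≤ Nat.card Ω) (hT : T.IsTree)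
    {F F'' : Subgroup (Equiv.Perm Ω)} (hs : IsSimpleGroup (typePreserving (c.G F F''))) :
    ∃ t ∈ F'', ∃ a, t a = a ∧ t ≠ 1 := by
  by_contra! hfree
  -- Local permutations at adjacent vertices agree on the shared color; under a free action they are
  -- equal.
  have hconst : ∀ g ∈ typePreserving (c.G F F''), ∀ x y, c.localPerm g x = c.localPerm g y := by
    intro g hg x y
    refine c.nb_induction hT (P := fun x => c.localPerm g x = c.localPerm g y) y rfl ?_ x
    intro x a ih
    have := hfree _ (F''.mul_mem (F''.inv_mem (hg.1.2 x)) (hg.1.2 (c.nb x a))) a (by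
      rw [Equiv.Perm.mul_apply, localPerm_nb]; simp)
    rw [← ih, ← inv_mul_eq_one, ← inv_inj, mul_inv_rev, inv_inv, inv_one, this]
  obtain ⟨v⟩ := hT.connected.nonempty
  obtain ⟨a⟩ : Nonempty Ω := by
    by_contra h
    rw [not_nonempty_iff] at h
    simp at hΩ
  obtain ⟨b, hba, -⟩ := exists_ne_and_ne_of_three_le_card hΩ a a
  obtain ⟨e, hea, heb⟩ := exists_ne_and_ne_of_three_le_card hΩ a b
  have hmem : ∀ g ∈ c.universalGroup ⊥, ∀ i j, g v = c.nb (c.nb v i) j →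
      g ∈ typePreserving (c.G F F'') := by
    intro g hg i j hgv
    refine (c.mem_typePreserving_iff hT v).2 ⟨universalGroup_bot_le_G hg, ?_⟩
    rw [hgv, even_dist_nb c hT, even_dist_nb c hT]
    simp
  obtain ⟨k, hk, hkv⟩ := c.exists_mem_universalGroup_bot hT v (c.nb (c.nb v b) e)
  obtain ⟨m, hm, hmv⟩ := c.exists_mem_universalGroup_bot hT v (c.nb (c.nb v a) b)
  have hk1 : k ≠ 1 := by
    rintro rfl
    have h : c.nb (c.nb v b) b = c.nb (c.nb v b) e := (c.nb_nb v b).trans hkv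
    exact heb (c.nb_injective _ h).symm
  -- With constant local permutations, conjugation preserves U(1), so simplicity forces the whole
  -- group into U(1).
  have hle : typePreserving (c.G F F'') ≤ c.universalGroup ⊥ := by
    refine Subgroup.le_of_isSimpleGroup ?_ (hmem k hk _ _ hkv) hk hk1
    intro h hh q hq x
    rw [Subgroup.mem_bot, localPerm_mul, localPerm_mul, localPerm_inv,
      localPerm_eq_one_of_mem hq, mul_one, mul_inv_eq_one]
    exact hconst h hh _ _
  classical
  -- `f` records the parity of the number of edges of color `a` on the path from `v`. Elements of
  -- U(1) preserve `f` or flip it everywhere; `k` preserves it and `m` flips it, so the stabilizer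
  -- `Q` of `f` contradicts simplicity.
  obtain ⟨f, -, hf⟩ := c.exists_lift hT (fun _ i x => if i = a then !x else x)
    (fun _ i x => by by_cases h : i = a <;> simp [h]) v true
  have hfmap : ∀ g ∈ c.universalGroup ⊥, ∀ x y, f (g x) = f (g y) ↔ f x = f y := by
    intro g hg x y
    refine c.nb_induction hT (P := fun x => f (g x) = f (g y) ↔ f x = f y) y (by simp) ?_ x
    intro x i ih
    rw [map_nb_of_mem_bot hg, hf, hf]
    split_ifs
    · rw [Bool.not_eq, Bool.not_eq, ne_eq, ne_eq, ih]
    · exact ih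
  let Q : Subgroup (T ≃g T) :=
    { carrier := {g | ∀ x, f (g x) = f x}
      one_mem' := fun _ => rfl
      mul_mem' := fun {g h} hg hh x => (hg (h x)).trans (hh x)
      inv_mem' := fun {g} hg x => by
        have := hg (g⁻¹ x)
        rw [RelIso.apply_inv_self] at this
        exact this.symm }
  have hkQ : k ∈ Q := by
    intro x
    have hkf : f (k v) = f v := by rw [hkv, hf, hf, if_neg hea, if_neg hba]
    by_cases hx : f x = f v
    · rw [(hfmap k hk x v).2 hx, hkf, hx]
    · have := (hfmap k hk x v).not.2 hx
      rw [hkf] at this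
      rw [Bool.eq_not_of_ne this, Bool.eq_not_of_ne hx]
  have hle' : typePreserving (c.G F F'') ≤ Q := by
    refine Subgroup.le_of_isSimpleGroup ?_ (hmem k hk _ _ hkv) hkQ hk1
    intro h hh q hq x
    have := (hfmap h (hle hh) (q (h⁻¹ x)) (h⁻¹ x)).2 (hq _)
    rwa [RelIso.apply_inv_self] at this
  have := hle' (hmem m hm _ _ hmv) v
  rw [hmv, hf, hf, if_neg hba, if_pos rfl] at this
  simp at this

/-! ### Parity of singularities for a subgroup of index two -/

section IndexTwo

variable {F F'' F' : Subgroup (Equiv.Perm Ω)}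

theorem mul_mem_iff_of_relIndex_two (hi : F''.relIndex F' = 2) {s t : Equiv.Perm Ω} (hs : s ∈ F')
    (ht : t ∈ F') : s * t ∈ F'' ↔ (s ∈ F'' ↔ t ∈ F'') := by
  have := Subgroup.mul_mem_iff_of_index_two (H := F''.subgroupOf F') hi (a := ⟨s, hs⟩) (b := ⟨t, ht⟩)
  simpa only [Subgroup.mem_subgroupOf, Subgroup.coe_mul] using this

variable {c}

theorem singularities_finite (h1 : F ≤ F'') {g : T ≃g T} (hg : g ∈ c.G F F') :
    (c.singularities F'' g).Finite := almostGroup_mono h1 hg.1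

theorem singularities_mul (hi : F''.relIndex F' = 2) {g h : T ≃g T} (hg : g ∈ c.universalGroup F')
    (hh : h ∈ c.universalGroup F') :
    c.singularities F'' (g * h) = symmDiff (c.singularities F'' h) (h ⁻¹' c.singularities F'' g) := by
  ext x
  have key := mul_mem_iff_of_relIndex_two hi (hg (h x)) (hh x)
  simp only [singularities, Set.mem_ofPred_eq, Set.mem_symmDiff, Set.mem_preimage, localPerm_mul,
    key]
  tauto

theorem G_mono_left (h1 : F ≤ F'') : c.G F F' ≤ c.G F'' F' :=
  inf_le_inf_right _ (almostGroup_mono h1)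

theorem G_mono_right (h2 : F'' ≤ F') : c.G F F'' ≤ c.G F F' :=
  inf_le_inf_left _ (universalGroup_mono h2)

theorem mem_G_of_singularities_eq_empty {g : T ≃g T} (hg : g ∈ c.G F F')
    (h : c.singularities F'' g = ∅) : g ∈ c.G F F'' :=
  ⟨hg.1, fun v => by
    by_contra hv
    exact Set.eq_empty_iff_forall_notMem.1 h v hv⟩

theorem even_singularitiesIn_mul (hi : F''.relIndex F' = 2) (r : V) {g h : T ≃g T}
    (hg : g ∈ typePreserving (c.G F'' F')) (hh : h ∈ typePreserving (c.G F'' F')) :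
    Even (c.singularitiesIn F'' r (g * h)).ncard ↔
      (Even (c.singularitiesIn F'' r g).ncard ↔ Even (c.singularitiesIn F'' r h).ncard) := by
  have hgf : (c.singularitiesIn F'' r g).Finite := hg.1.1.subset Set.inter_subset_left
  have hhf : (c.singularitiesIn F'' r h).Finite := hh.1.1.subset Set.inter_subset_left
  rw [singularitiesIn_mul c hi r hg hh, even_ncard_symmDiff_iff hhf
    (hgf.preimage h.injective.injOn), preimage_ncard]
  tauto

theorem even_singularitiesIn_inv (hi : F''.relIndex F' = 2) (r : V) {g : T ≃g T}
    (hg : g ∈ typePreserving (c.G F'' F')) :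
    Even (c.singularitiesIn F'' r g⁻¹).ncard ↔ Even (c.singularitiesIn F'' r g).ncard := by
  have := even_singularitiesIn_mul hi r hg (Subgroup.inv_mem _ hg)
  rw [mul_inv_cancel] at this
  have h1 : c.singularitiesIn F'' r 1 = ∅ := by
    simp [singularitiesIn, singularities, localPerm_one, F''.one_mem]
  rw [h1] at this
  simp only [Set.ncard_empty, Even.zero, true_iff] at this
  exact this.symm

variable (c)

theorem exists_single_singularity (hT : T.IsTree) (h1 : F ≤ F'') (h2 : F'' ≤ F')
    (hY : F' ≤ youngSubgroup F) (hi : F''.relIndex F' = 2) (v : V) :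
    ∃ g ∈ typePreserving (c.G F F'), g v = v ∧ c.singularities F'' g = {v} := by
  obtain ⟨s, hs, hs'⟩ : ∃ s ∈ F', s ∉ F'' := by
    by_contra! h
    rw [Subgroup.relIndex_eq_one.2 h] at hi
    omega
  obtain ⟨g, hgv, hg, hgF, -⟩ := c.exists_singular hT F v (hY hs)
  refine ⟨g, c.mem_typePreserving_of_fixed hT
    (c.mem_G_of_singular (h1.trans h2) (hg ▸ hs) hgF) hgv, hgv, ?_⟩
  ext x
  rw [Set.mem_singleton_iff]
  refine ⟨fun hx => ?_, fun hx => ?_⟩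
  · by_contra hne
    exact hx (h1 (hgF x hne))
  · rw [hx, singularities, Set.mem_ofPred_eq, hg]
    exact hs'

/-- The elements of `G(F, F')^⋆` whose number of singularities with respect to `F''` is even in
the block of `v₀` and in the block of `v₁`. -/
def evenPart (F : Subgroup (Equiv.Perm Ω)) (hi : F''.relIndex F' = 2) (v₀ v₁ : V) :
    Subgroup (T ≃g T) :=
  c.evenGroup F'' F' hi v₀ ⊓ c.evenGroup F'' F' hi v₁ ⊓ c.G F F'

variable {c}

theorem mem_evenPart (h1 : F ≤ F'') (hi : F''.relIndex F' = 2) {v₀ v₁ : V} {g : T ≃g T} :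
    g ∈ c.evenPart F hi v₀ v₁ ↔ g ∈ typePreserving (c.G F F') ∧
      Even (c.singularitiesIn F'' v₀ g).ncard ∧ Even (c.singularitiesIn F'' v₁ g).ncard :=
  ⟨fun h => ⟨⟨h.2, h.1.1.1.2⟩, h.1.1.2, h.1.2.2⟩, fun h =>
    have := typePreserving_mono (G_mono_left h1) h.1
    ⟨⟨⟨this, h.2.1⟩, this, h.2.2⟩, h.1.1⟩⟩

theorem evenPart_le_typePreserving (h1 : F ≤ F'') (hi : F''.relIndex F' = 2) {v₀ v₁ : V} :
    c.evenPart F hi v₀ v₁ ≤ typePreserving (c.G F F') := fun _ h => ((mem_evenPart h1 hi).1 h).1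

theorem typePreserving_le_evenPart (h1 : F ≤ F'') (h2 : F'' ≤ F') (hi : F''.relIndex F' = 2)
    {v₀ v₁ : V} : typePreserving (c.G F F'') ≤ c.evenPart F hi v₀ v₁ := fun g hg => by
  have : c.singularities F'' g = ∅ := Set.eq_empty_iff_forall_notMem.2 fun v hv => hv (hg.1.2 v)
  exact (mem_evenPart h1 hi).2 ⟨typePreserving_mono (G_mono_right h2) hg,
    by simp [singularitiesIn, this], by simp [singularitiesIn, this]⟩

/-- Both parities are homomorphisms to a group of order two, hence invariant under conjugation. -/
theorem conj_mem_evenPart (h1 : F ≤ F'') (hi : F''.relIndex F' = 2) {v₀ v₁ : V} {g m : T ≃g T}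
    (hg : g ∈ typePreserving (c.G F F')) (hm : m ∈ c.evenPart F hi v₀ v₁) :
    g * m * g⁻¹ ∈ c.evenPart F hi v₀ v₁ := by
  have hle := typePreserving_mono (c.G_mono_left (F' := F') h1)
  rw [mem_evenPart h1] at hm ⊢
  refine ⟨mul_mem (mul_mem hg hm.1) (inv_mem hg), ?_⟩
  have hg' := hle hg
  have hm' := hle hm.1
  constructor <;>
  · rw [even_singularitiesIn_mul hi _ (mul_mem hg' hm') (inv_mem hg'),
      even_singularitiesIn_mul hi _ hg' hm', even_singularitiesIn_inv hi _ hg']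
    tauto

open scoped commutatorElement in
theorem commutator_mem_evenPart (h1 : F ≤ F'') (hi : F''.relIndex F' = 2) {v₀ v₁ : V}
    {g k : T ≃g T} (hg : g ∈ typePreserving (c.G F F')) (hk : k ∈ typePreserving (c.G F F')) :
    ⁅g, k⁆ ∈ c.evenPart F hi v₀ v₁ := by
  have hle := typePreserving_mono (c.G_mono_left (F' := F') h1)
  rw [mem_evenPart h1, commutatorElement_def]
  refine ⟨mul_mem (mul_mem (mul_mem hg hk) (inv_mem hg)) (inv_mem hk), ?_⟩
  have hg' := hle hg
  have hk' := hle hk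
  constructor <;>
  · rw [even_singularitiesIn_mul hi _ (mul_mem (mul_mem hg' hk') (inv_mem hg')) (inv_mem hk'),
      even_singularitiesIn_mul hi _ (mul_mem hg' hk') (inv_mem hg'),
      even_singularitiesIn_mul hi _ hg' hk', even_singularitiesIn_inv hi _ hg',
      even_singularitiesIn_inv hi _ hk']
    tauto

end IndexTwo

end LegalColoring

namespace LegalColoring

variable {V : Type u} {T : SimpleGraph V} {Ω : Type w} (c : LegalColoring T Ω)
variable {F F'' F' : Subgroup (Equiv.Perm Ω)}

/-! ### The index of the even part -/

theorem relIndex_typePreserving_G [Finite Ω] (hΩ : 3 ≤ Nat.card Ω) (hT : T.IsTree) :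
    (typePreserving (c.G F F')).relIndex (c.G F F') = 2 := by
  obtain ⟨v⟩ := hT.connected.nonempty
  obtain ⟨i⟩ : Nonempty Ω := by
    by_contra h
    rw [not_nonempty_iff] at h
    simp at hΩ
  obtain ⟨a, ha, hav⟩ := c.exists_mem_universalGroup_bot hT v (c.nb v i)
  have haG : a ∈ c.G F F' := universalGroup_bot_le_G ha
  refine Subgroup.relIndex_eq_two_iff.2 ⟨a, haG, fun b hb => ?_⟩
  rw [c.mem_typePreserving_iff hT v, c.mem_typePreserving_iff hT v, RelIso.mul_apply, hav, map_nb,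
    even_dist_nb c hT]
  simp only [hb, mul_mem hb haG, true_and]
  by_cases h : Even (T.dist v (b v)) <;> simp [h, Xor]

/-- Uses a chain of three subgroups of index two. Taking both vertices equal to `v₀` in `evenPart`
imposes the parity condition on one block only. -/
theorem relIndex_evenPart [Finite Ω] (hΩ : 3 ≤ Nat.card Ω) (hT : T.IsTree)
    (h1 : F ≤ F'') (h2 : F'' ≤ F') (hY : F' ≤ youngSubgroup F) (hi : F''.relIndex F' = 2)
    {v₀ v₁ : V} (hv : T.Adj v₀ v₁) :
    (c.evenPart F hi v₀ v₁).relIndex (c.G F F') = 8 := by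
  have hle := typePreserving_mono (c.G_mono_left (F' := F') h1)
  have hEle : c.evenPart F hi v₀ v₀ ≤ typePreserving (c.G F F') := evenPart_le_typePreserving h1 hi
  have hMle : c.evenPart F hi v₀ v₁ ≤ c.evenPart F hi v₀ v₀ := fun g hg =>
    ⟨⟨hg.1.1, hg.1.1⟩, hg.2⟩
  obtain ⟨e, rfl⟩ := c.exists_nb_eq hv
  have i1 : (c.evenPart F hi v₀ v₀).relIndex (typePreserving (c.G F F')) = 2 := by
    obtain ⟨a, ha, -, has⟩ := c.exists_single_singularity hT h1 h2 hY hi v₀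
    refine Subgroup.relIndex_eq_two_iff.2 ⟨a, ha, fun b hb => ?_⟩
    have hodd : ¬ Even (c.singularitiesIn F'' v₀ a).ncard := by
      have : c.singularitiesIn F'' v₀ a = {v₀} := by
        rw [singularitiesIn, has, Set.inter_eq_left, Set.singleton_subset_iff]
        simp [evenBlock]
      simp [this]
    rw [mem_evenPart h1, mem_evenPart h1, even_singularitiesIn_mul hi _ (hle hb) (hle ha)]
    simp only [hb, mul_mem hb ha, true_and, hodd]
    by_cases h : Even (c.singularitiesIn F'' v₀ b).ncard <;> simp [h, Xor]
  have i2 : (c.evenPart F hi v₀ (c.nb v₀ e)).relIndex (c.evenPart F hi v₀ v₀) = 2 := by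
    obtain ⟨a, ha, -, has⟩ := c.exists_single_singularity hT h1 h2 hY hi (c.nb v₀ e)
    have hodd : ¬ Even (c.singularitiesIn F'' (c.nb v₀ e) a).ncard := by
      have : c.singularitiesIn F'' (c.nb v₀ e) a = {c.nb v₀ e} := by
        rw [singularitiesIn, has, Set.inter_eq_left, Set.singleton_subset_iff]
        simp [evenBlock]
      simp [this]
    have heven : Even (c.singularitiesIn F'' v₀ a).ncard := by
      have : c.singularitiesIn F'' v₀ a = ∅ := by
        rw [singularitiesIn, has, Set.singleton_inter_eq_empty, evenBlock, Set.mem_ofPred_eq,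
          even_dist_nb c hT]
        simp
      simp [this]
    have haE : a ∈ c.evenPart F hi v₀ v₀ := (mem_evenPart h1 hi).2 ⟨ha, heven, heven⟩
    refine Subgroup.relIndex_eq_two_iff.2 ⟨a, haE, fun b hb => ?_⟩
    have hb' := (mem_evenPart h1 hi).1 hb
    rw [mem_evenPart h1, mem_evenPart h1, even_singularitiesIn_mul hi _ (hle hb'.1) (hle ha),
      even_singularitiesIn_mul hi _ (hle hb'.1) (hle ha)]
    simp only [hb'.1, hb'.2.1, mul_mem hb'.1 ha, true_and, hodd, heven]
    by_cases h : Even (c.singularitiesIn F'' (c.nb v₀ e) b).ncard <;> simp [h, Xor]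
  have hG : typePreserving (c.G F F') ≤ c.G F F' := fun _ h => h.1
  rw [← Subgroup.relIndex_mul_relIndex _ _ _ (hMle.trans hEle) hG,
    ← Subgroup.relIndex_mul_relIndex _ _ _ hMle hEle, i1, i2, c.relIndex_typePreserving_G hΩ hT]

/-! ### Simplicity of the even part -/

/-- Commuting a nontrivial `p` of `P` with a suitable `h` lands in the simple group. `P` need not
lie in `evenPart`, so the lemma also applies to conjugates. -/
theorem typePreserving_G_le_of_normalized [Finite Ω] (hΩ : 3 ≤ Nat.card Ω) (hT : T.IsTree)
    (h1 : F ≤ F'') (h2 : F'' ≤ F') (hY : F' ≤ youngSubgroup F) (hi : F''.relIndex F' = 2)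
    [hs : IsSimpleGroup (typePreserving (c.G F F''))] {P : Subgroup (T ≃g T)}
    (hP : P ≤ typePreserving (c.G F F')) (hne : P ≠ ⊥)
    (hconj : ∀ h ∈ typePreserving (c.G F F''), ∀ p ∈ P, h * p * h⁻¹ ∈ P) :
    typePreserving (c.G F F'') ≤ P := by
  obtain ⟨p, hp, hp1⟩ := P.ne_bot_iff_exists_ne_one.1 hne |>.elim fun p h =>
    (⟨p, p.2, fun h' => h (Subtype.ext h')⟩ : ∃ p, p ∈ P ∧ p ≠ 1)
  obtain ⟨t, ht, a, hta, ht1⟩ := c.exists_fixed_of_isSimpleGroup hΩ hT hs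
  obtain ⟨x, e, hx⟩ := c.exists_half_disjoint_image hΩ hT hp1
  obtain ⟨h, hG, hout, hS, z, hz, hhz⟩ := c.exists_supported_half hΩ hT h1 ht (hY (h2 ht)) hta ht1
    x e (c.singularities_finite h1 (hP hp).1)
  have hhT : h ∈ typePreserving (c.G F F'') :=
    c.mem_typePreserving_of_fixed hT hG (hout x (c.notMem_half_self hT x e))
  have hhT' := typePreserving_mono (G_mono_right h2) hhT
  have hcomm : p * h * p⁻¹ * h⁻¹ ≠ 1 := fun heq => by
    have h2 : p * h = h * p := by
      rwa [mul_inv_eq_one, mul_inv_eq_iff_eq_mul] at heq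
    have h3 : p (h z) = h (p z) := congrArg (fun k : T ≃g T => k z) h2
    rw [hout _ (hx z hz)] at h3
    exact hhz (p.injective h3)
  have hmemP : p * h * p⁻¹ * h⁻¹ ∈ P := by
    have := mul_mem hp (hconj h hhT _ (inv_mem hp))
    simpa only [mul_assoc] using this
  refine Subgroup.le_of_isSimpleGroup hconj ?_ hmemP hcomm
  refine mul_mem ⟨⟨?_, fun y => ?_⟩, ?_⟩ (inv_mem hhT)
  · exact (mul_mem (mul_mem (hP hp) hhT') (inv_mem (hP hp))).1.1
  · have hpy := (hP hp).1.2 (p⁻¹ y)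
    have hhy := hG.2 (p⁻¹ y)
    rw [localPerm_mul, localPerm_mul, localPerm_inv]
    -- At a singularity of `p`, fixed by `h`, the local permutation of `p * h * p⁻¹` is a conjugate
    -- of an element of `F''`, which is normal in `F'`. Elsewhere all three factors lie in `F''`.
    by_cases hy : p⁻¹ y ∈ c.singularities F'' p
    · rw [hS _ hy, mul_mem_iff_of_relIndex_two hi (mul_mem hpy (h2 hhy)) (inv_mem hpy),
        mul_mem_iff_of_relIndex_two hi hpy (h2 hhy), inv_mem_iff]
      simp [hhy]
    · have hy' : p⁻¹ y ∉ c.singularities F'' p := hy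
      have hhy' : h (p⁻¹ y) ∉ c.singularities F'' p := fun hmem =>
        hy (by have := h.injective (hS _ hmem); rwa [this] at hmem)
      simp only [singularities, Set.mem_ofPred_eq, not_not] at hy' hhy'
      exact mul_mem (mul_mem hhy' hhy) (inv_mem hy')
  · exact (mul_mem (mul_mem (hP hp) hhT') (inv_mem (hP hp))).2

/-- A block containing a singularity contains an even number of them, hence a second one. -/
theorem exists_ne_mem_singularities (hT : T.IsTree) (h1 : F ≤ F'') (hi : F''.relIndex F' = 2)
    {v₀ v₁ : V} (hv : T.Adj v₀ v₁) {g : T ≃g T} (hg : g ∈ c.evenPart F hi v₀ v₁)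
    (hgs : (c.singularities F'' g).Nonempty) :
    ∃ v ∈ c.singularities F'' g, ∃ x ∈ c.singularities F'' g, x ≠ v ∧ Even (T.dist v x) := by
  obtain ⟨v, hvs⟩ := hgs
  have key : ∀ r, Even (T.dist r v) → Even (c.singularitiesIn F'' r g).ncard →
      ∃ x ∈ c.singularities F'' g, x ≠ v ∧ Even (T.dist v x) := by
    intro r hr he
    by_contra! hcon
    have : c.singularitiesIn F'' r g = {v} := by
      refine Set.Subset.antisymm (fun x hx => ?_) (Set.singleton_subset_iff.2 ⟨hvs, hr⟩)
      by_contra hne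
      refine hcon x hx.1 hne ((c.even_dist_iff hT r _ _).2 ?_)
      exact iff_of_true hr hx.2
    rw [this] at he
    simp at he
  rw [mem_evenPart h1] at hg
  refine ⟨v, hvs, ?_⟩
  by_cases h : Even (T.dist v₀ v)
  · exact key v₀ h hg.2.1
  · refine key v₁ ?_ hg.2.2
    obtain ⟨a, rfl⟩ := c.exists_nb_eq hv
    rw [c.even_dist_iff hT v₀, even_dist_nb c hT]
    simp [h]

/-- Strong induction on the number of singularities: two of them in one block are cancelled by a
factor from `P`. -/
theorem evenPart_le_of_normalized [Finite Ω] (hΩ : 3 ≤ Nat.card Ω) (hT : T.IsTree)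
    (h1 : F ≤ F'') (h2 : F'' ≤ F') (hY : F' ≤ youngSubgroup F) (hi : F''.relIndex F' = 2)
    [hs : IsSimpleGroup (typePreserving (c.G F F''))] {v₀ v₁ : V} (hv : T.Adj v₀ v₁)
    {P : Subgroup (T ≃g T)} (hP : P ≤ c.evenPart F hi v₀ v₁) (hne : P ≠ ⊥)
    (hconj : ∀ m ∈ c.evenPart F hi v₀ v₁, ∀ p ∈ P, m * p * m⁻¹ ∈ P) :
    c.evenPart F hi v₀ v₁ ≤ P := by
  have hMT := c.evenPart_le_typePreserving h1 hi (v₀ := v₀) (v₁ := v₁)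
  have hHM := c.typePreserving_le_evenPart h1 h2 hi (v₀ := v₀) (v₁ := v₁)
  have hH : ∀ g ∈ typePreserving (c.G F F'), ∀ h ∈ typePreserving (c.G F F''), g * h * g⁻¹ ∈ P := by
    intro g hg
    -- The preimage is g⁻¹Pg, still normalized by H because `g` normalizes `evenPart`.
    refine c.typePreserving_G_le_of_normalized hΩ hT h1 h2 hY hi
      (P := P.comap (MulAut.conj g).toMonoidHom) ?_ ?_ ?_
    · intro x hx
      have := hMT (hP (show g * x * g⁻¹ ∈ P from hx))
      have := mul_mem (mul_mem (inv_mem hg) this) hg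
      simpa [mul_assoc] using this
    · intro hbot
      refine hne (eq_bot_iff.2 fun p hp => ?_)
      have : g⁻¹ * p * g ∈ P.comap (MulAut.conj g).toMonoidHom := by
        change g * (g⁻¹ * p * g) * g⁻¹ ∈ P
        simpa [mul_assoc] using hp
      rw [hbot, Subgroup.mem_bot] at this
      rw [Subgroup.mem_bot]
      have h := congrArg (fun k => g * k * g⁻¹) this
      simpa [mul_assoc] using h
    · intro h hh x hx
      have := hconj _ (conj_mem_evenPart h1 hi hg (hHM hh)) _ (show g * x * g⁻¹ ∈ P from hx)
      change g * (h * x * h⁻¹) * g⁻¹ ∈ P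
      simpa [mul_assoc] using this
  have hHP : typePreserving (c.G F F'') ≤ P := fun h hh => by
    simpa using hH 1 (Subgroup.one_mem _) h hh
  suffices H : ∀ n, ∀ g ∈ c.evenPart F hi v₀ v₁, (c.singularities F'' g).ncard = n → g ∈ P from
    fun g hg => H _ g hg rfl
  intro n
  induction n using Nat.strong_induction_on with
  | _ n ih =>
  intro g hg hn
  have hgG := (hMT hg).1
  rcases Set.eq_empty_or_nonempty (c.singularities F'' g) with hempty | hnon
  · exact hHP ⟨mem_G_of_singularities_eq_empty hgG hempty, (hMT hg).2⟩
  obtain ⟨v, hvs, x, hxs, hxv, hdist⟩ := c.exists_ne_mem_singularities hT h1 hi hv hg hnon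
  -- Dividing by an element whose only singularity is `v` removes `v` and transports the others by
  -- `a`.
  have hstep : ∀ (g : T ≃g T), g ∈ c.G F F' → ∀ (a : T ≃g T) (v : V), a ∈ c.G F F' →
      c.singularities F'' a = {v} → v ∈ c.singularities F'' g →
      a ⁻¹' (c.singularities F'' (g * a⁻¹)) = c.singularities F'' g \ {v} := by
    intro g hg a v ha has hvg
    have h := singularities_mul hi (mul_mem hg (inv_mem ha)).2 ha.2
    rw [inv_mul_cancel_right, has] at h
    ext y
    rw [h, Set.mem_sdiff, Set.mem_symmDiff]
    rw [h, Set.mem_symmDiff] at hvg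
    by_cases hy : y = v
    · subst hy
      simp only [Set.mem_singleton_iff, true_and] at hvg ⊢
      tauto
    · simp [hy]
  obtain ⟨a, ha, hav, has⟩ := c.exists_single_singularity hT h1 h2 hY hi v
  -- After division by `a`, the singularity `x` sits at `a x`. The conjugate `h * a * h⁻¹`, whose
  -- only singularity is there, removes it.
  obtain ⟨h, hh, hhv⟩ := c.exists_mem_universalGroup_bot hT v (a x)
  have hhH : h ∈ typePreserving (c.G F F'') :=
    (c.mem_typePreserving_iff hT v).2 ⟨universalGroup_bot_le_G hh, by
      rw [hhv]
      exact (c.even_dist_map_iff hT (v := v) (by rw [hav]; simp) v x).2 hdist⟩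
  have hhH' := typePreserving_mono (G_mono_right h2) hhH
  have hb : h * a * h⁻¹ ∈ typePreserving (c.G F F') := mul_mem (mul_mem hhH' ha) (inv_mem hhH')
  have hbs : c.singularities F'' (h * a * h⁻¹) = {a x} := by
    ext y
    have hiff : y ∈ c.singularities F'' (h * a * h⁻¹) ↔ h⁻¹ y ∈ c.singularities F'' a := by
      simp only [singularities, Set.mem_ofPred_eq, localPerm_mul, localPerm_inv,
        localPerm_eq_one_of_mem hh, one_mul, inv_one, mul_one]
    rw [hiff, has, Set.mem_singleton_iff, Set.mem_singleton_iff, ← hhv]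
    constructor
    · rintro rfl; simp
    · rintro rfl; simp
  have hfin := c.singularities_finite h1 hgG
  have e1 := hstep g hgG a v ha.1 has hvs
  have hxs1 : a x ∈ c.singularities F'' (g * a⁻¹) := by
    have : x ∈ a ⁻¹' (c.singularities F'' (g * a⁻¹)) := by rw [e1]; exact ⟨hxs, hxv⟩
    exact this
  have e2 := hstep (g * a⁻¹) (mul_mem hgG (inv_mem ha.1)) _ (a x) hb.1 hbs hxs1
  have n1 : (c.singularities F'' (g * a⁻¹)).ncard < n := by
    rw [← preimage_ncard a, e1, ← hn]
    exact Set.ncard_sdiff_singleton_lt_of_mem hvs hfin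
  have n2 : (c.singularities F'' (g * a⁻¹ * (h * a * h⁻¹)⁻¹)).ncard < n := by
    refine lt_of_le_of_lt ?_ n1
    rw [← preimage_ncard (h * a * h⁻¹), e2]
    exact Set.ncard_le_ncard Set.sdiff_subset
      (c.singularities_finite h1 (mul_mem hgG (inv_mem ha.1)))
  have ha2 : a * a ∈ P := by
    refine hHP ⟨mem_G_of_singularities_eq_empty (mul_mem ha ha).1 ?_, (mul_mem ha ha).2⟩
    rw [singularities_mul hi ha.1.2 ha.1.2, has]
    have : a ⁻¹' {v} = {v} := by
      ext y
      simp only [Set.mem_preimage, Set.mem_singleton_iff]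
      conv_lhs => rw [← hav]
      exact a.injective.eq_iff
    rw [this, symmDiff_self]; rfl
  -- h a h⁻¹ a = h · (a h⁻¹ a⁻¹) · a²: the first factor is in H, the second in a conjugate of H, and
  -- a² has no singularities.
  have hba : h * a * h⁻¹ * a ∈ P := by
    have := mul_mem (mul_mem (hHP hhH) (hH a ha _ (inv_mem hhH))) ha2
    simpa [mul_assoc] using this
  have hrest : g * a⁻¹ * (h * a * h⁻¹)⁻¹ = g * (h * a * h⁻¹ * a)⁻¹ := by group
  have := ih _ n2 (g * a⁻¹ * (h * a * h⁻¹)⁻¹) (by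
    rw [hrest]; exact mul_mem hg (inv_mem (hP hba))) rfl
  rw [hrest] at this
  have := mul_mem this hba
  rwa [inv_mul_cancel_right] at this

theorem isSimpleGroup_evenPart [Finite Ω] (hΩ : 3 ≤ Nat.card Ω) (hT : T.IsTree)
    (h1 : F ≤ F'') (h2 : F'' ≤ F') (hY : F' ≤ youngSubgroup F) (hi : F''.relIndex F' = 2)
    [hs : IsSimpleGroup (typePreserving (c.G F F''))] {v₀ v₁ : V} (hv : T.Adj v₀ v₁) :
    IsSimpleGroup (c.evenPart F hi v₀ v₁) := by
  refine Subgroup.isSimpleGroup_of_forall_le ?_ fun P hP hconj hne =>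
    c.evenPart_le_of_normalized hΩ hT h1 h2 hY hi hv hP hne hconj
  intro hbot
  have := c.typePreserving_le_evenPart h1 h2 hi (v₀ := v₀) (v₁ := v₁)
  rw [hbot] at this
  exact (Subgroup.nontrivial_iff_ne_bot _).1 hs.toNontrivial (le_bot_iff.1 this)

/-! ### The group generated by the derived subgroups of the edge fixators -/

theorem mem_edgeFixator_iff {H : Subgroup (T ≃g T)} {x y : V} (h : T.Adj x y) {g : T ≃g T} :
    g ∈ edgeFixator H ⟨s(x, y), h⟩ ↔ g ∈ H ∧ g x = x ∧ g y = y := by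
  change (g ∈ H ∧ ∀ z ∈ s(x, y), g z = z) ↔ _
  simp

theorem N_le_evenPart (hT : T.IsTree) (h1 : F ≤ F'') (hi : F''.relIndex F' = 2) {v₀ v₁ : V} :
    c.N F F' ≤ c.evenPart F hi v₀ v₁ := by
  refine iSup_le fun ⟨e, he⟩ => ?_
  induction e using Sym2.ind with
  | _ x y =>
  have hle : edgeFixator (c.G F F') ⟨s(x, y), he⟩ ≤ typePreserving (c.G F F') := fun g hg =>
    c.mem_typePreserving_of_fixed hT hg.1 ((mem_edgeFixator_iff he).1 hg).2.1
  rw [Subgroup.commutator_le]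
  exact fun g hg k hk => commutator_mem_evenPart h1 hi (hle hg) (hle hk)

open scoped commutatorElement in
theorem conj_mem_N {g n : T ≃g T} (hg : g ∈ c.G F F') (hn : n ∈ c.N F F') :
    g * n * g⁻¹ ∈ c.N F F' := by
  suffices h : c.N F F' ≤ (c.N F F').comap (MulAut.conj g).toMonoidHom from h hn
  refine iSup_le fun ⟨e, he⟩ => ?_
  induction e using Sym2.ind with
  | _ x y =>
  have hadj : T.Adj (g x) (g y) := g.map_adj_iff.2 he
  have hmem : ∀ k ∈ edgeFixator (c.G F F') ⟨s(x, y), he⟩,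
      g * k * g⁻¹ ∈ edgeFixator (c.G F F') ⟨s(g x, g y), hadj⟩ := by
    intro k hk
    replace hk := (mem_edgeFixator_iff he).1 hk
    refine (mem_edgeFixator_iff hadj).2 ⟨mul_mem (mul_mem hg hk.1) (inv_mem hg), ?_, ?_⟩ <;> simp [hk.2]
  rw [Subgroup.commutator_le]
  intro k hk l hl
  have := Subgroup.commutator_mem_commutator (hmem k hk) (hmem l hl)
  rw [← conjugate_commutatorElement] at this
  exact le_iSup (fun e : T.edgeSet => ⁅edgeFixator (c.G F F') e, edgeFixator (c.G F F') e⁆) _ this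

-- Take `h` fixing `v` with local permutation `t` there, and `k` supported in `half v b` with `t b ≠
-- b`. Both fix the edge of color `a` at `v`, but `h` moves `half v b` to a disjoint branch, so they
-- do not commute.
open scoped commutatorElement in
theorem N_ne_bot [Finite Ω] (hΩ : 3 ≤ Nat.card Ω) (hT : T.IsTree) (hF : F ≤ F')
    (hY : F' ≤ youngSubgroup F) {t : Equiv.Perm Ω} (ht : t ∈ F') {a : Ω} (hta : t a = a)
    (ht1 : t ≠ 1) : c.N F F' ≠ ⊥ := by
  obtain ⟨v⟩ := hT.connected.nonempty
  obtain ⟨b, hb⟩ : ∃ b, t b ≠ b := by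
    by_contra! h
    exact ht1 (Equiv.ext h)
  have hab : a ≠ b := fun h => hb (h ▸ hta)
  obtain ⟨h, hhv, hhs, hhF, -⟩ := c.exists_singular hT F v (hY ht)
  obtain ⟨k, hkG, hkout, -, y, hy, hky⟩ :=
    c.exists_supported_half hΩ hT hF ht (hY ht) hta ht1 v b Set.finite_empty
  have hfixh : h ∈ edgeFixator (c.G F F') ⟨s(v, c.nb v a), c.adj_nb v a⟩ := by
    rw [mem_edgeFixator_iff]
    exact ⟨c.mem_G_of_singular hF (hhs ▸ ht) hhF, hhv, by rw [map_nb, hhv, hhs, hta]⟩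
  have hfixk : k ∈ edgeFixator (c.G F F') ⟨s(v, c.nb v a), c.adj_nb v a⟩ := by
    rw [mem_edgeFixator_iff]
    exact ⟨hkG, hkout _ (c.notMem_half_self hT v b), hkout _
      (Set.disjoint_left.1 (c.disjoint_half hT v hab) (c.nb_mem_half v a))⟩
  intro hbot
  have hmem : ⁅h, k⁆ ∈ c.N F F' :=
    le_iSup (fun e : T.edgeSet => ⁅edgeFixator (c.G F F') e, edgeFixator (c.G F F') e⁆) _
      (Subgroup.commutator_mem_commutator hfixh hfixk)
  rw [hbot, Subgroup.mem_bot, commutatorElement_eq_one_iff_mul_comm] at hmem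
  have h3 : h (k y) = k (h y) := congrArg (fun k : T ≃g T => k y) hmem
  rw [← c.map_mem_half hT h, hhv, hhs] at hy
  rw [hkout _ (Set.disjoint_left.1 (c.disjoint_half hT v hb) hy)] at h3
  exact hky (h.injective h3)

theorem N_eq_evenPart [Finite Ω] (hΩ : 3 ≤ Nat.card Ω) (hT : T.IsTree)
    (h1 : F ≤ F'') (h2 : F'' ≤ F') (hY : F' ≤ youngSubgroup F) (hi : F''.relIndex F' = 2)
    [hs : IsSimpleGroup (typePreserving (c.G F F''))] {v₀ v₁ : V} (hv : T.Adj v₀ v₁) :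
    c.N F F' = c.evenPart F hi v₀ v₁ := by
  obtain ⟨t, ht, a, hta, ht1⟩ := c.exists_fixed_of_isSimpleGroup hΩ hT hs
  refine le_antisymm (c.N_le_evenPart hT h1 hi) ?_
  exact c.evenPart_le_of_normalized hΩ hT h1 h2 hY hi hv (c.N_le_evenPart hT h1 hi)
    (c.N_ne_bot hΩ hT (h1.trans h2) hY (h2 ht) hta ht1) fun m hm n hn =>
    c.conj_mem_N (evenPart_le_typePreserving h1 hi hm).1 hn

end LegalColoring

/-- Automorphisms preserving disjoint sets of vertices, and fixing the edges that leave these sets,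
can be glued together and extended by the identity. -/
theorem SimpleGraph.exists_iso_glue {V : Type u} {T : SimpleGraph V} {ι : Type*}
    (B : ι → Set V) (hB : ∀ i j z, z ∈ B i → z ∈ B j → i = j) (u : ι → T ≃g T)
    (hu : ∀ i z, u i z ∈ B i ↔ z ∈ B i)
    (hb : ∀ i z z', T.Adj z z' → z ∈ B i → z' ∉ B i → u i z = z) :
    ∃ g : T ≃g T, (∀ i, ∀ z ∈ B i, g z = u i z) ∧ ∀ z, (∀ i, z ∉ B i) → g z = z := by
  classical
  have key : ∀ u : ι → T ≃g T, (∀ i z z', T.Adj z z' → z ∈ B i → z' ∉ B i → u i z = z) →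
      ∃ f : V → V, (∀ i, ∀ z ∈ B i, f z = u i z) ∧ (∀ z, (∀ i, z ∉ B i) → f z = z) ∧
        ∀ z z', T.Adj z z' → T.Adj (f z) (f z') := by
    intro u hb
    let f : V → V := fun z => if h : ∃ i, z ∈ B i then u h.choose z else z
    have hf1 : ∀ i, ∀ z ∈ B i, f z = u i z := fun i z hz => by
      have h : ∃ i, z ∈ B i := ⟨i, hz⟩
      simp only [f, dif_pos h, hB _ _ _ h.choose_spec hz]
    have hf2 : ∀ z, (∀ i, z ∉ B i) → f z = z := fun z hz => by
      simp only [f, dif_neg (not_exists.2 hz)]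
    refine ⟨f, hf1, hf2, fun z z' h => ?_⟩
    have hfix : ∀ z z', T.Adj z z' → (∀ i, z ∈ B i → z' ∉ B i) → f z = z := by
      intro z z' h hn
      by_cases hz : ∃ i, z ∈ B i
      · obtain ⟨i, hi⟩ := hz
        rw [hf1 i z hi, hb i z z' h hi (hn i hi)]
      · exact hf2 z (not_exists.1 hz)
    by_cases hzz : ∃ i, z ∈ B i ∧ z' ∈ B i
    · obtain ⟨i, hi, hi'⟩ := hzz
      rw [hf1 i z hi, hf1 i z' hi']
      exact (u i).map_adj_iff.2 h
    · rw [hfix z z' h fun i hi hi' => hzz ⟨i, hi, hi'⟩,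
        hfix z' z h.symm fun i hi hi' => hzz ⟨i, hi', hi⟩]
      exact h
  have hu' : ∀ i z, (u i)⁻¹ z ∈ B i ↔ z ∈ B i := fun i z => by
    rw [← hu i, RelIso.apply_inv_self]
  obtain ⟨f, hf1, hf2, hf⟩ := key u hb
  obtain ⟨k, hk1, hk2, hk⟩ := key (fun i => (u i)⁻¹) fun i z z' h hz hz' => by
    conv_lhs => rw [← hb i z z' h hz hz']
    exact RelIso.inv_apply_self _ _
  have hkf : ∀ z, k (f z) = z := fun z => by
    by_cases hz : ∃ i, z ∈ B i
    · obtain ⟨i, hi⟩ := hz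
      rw [hf1 i z hi, hk1 i _ ((hu i z).2 hi), RelIso.inv_apply_self]
    · rw [hf2 z (not_exists.1 hz), hk2 z (not_exists.1 hz)]
  have hfk : ∀ z, f (k z) = z := fun z => by
    by_cases hz : ∃ i, z ∈ B i
    · obtain ⟨i, hi⟩ := hz
      rw [hk1 i z hi, hf1 i _ ((hu' i z).2 hi), RelIso.apply_inv_self]
    · rw [hk2 z (not_exists.1 hz), hf2 z (not_exists.1 hz)]
  exact ⟨⟨⟨f, k, hkf, hfk⟩, fun {z z'} => ⟨fun h => by simpa [hkf] using hk _ _ h, hf z z'⟩⟩,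
    hf1, hf2⟩

/-! ### Gluing in U(F), commutators and displacement -/

namespace LegalColoring

variable {V : Type u} {T : SimpleGraph V} {Ω : Type w} (c : LegalColoring T Ω)
variable {F : Subgroup (Equiv.Perm Ω)}

theorem mem_typePreserving_G_self {g : T ≃g T} :
    g ∈ typePreserving (c.G F F) ↔ g ∈ typePreserving (c.universalGroup F) :=
  ⟨fun h => ⟨h.1.2, h.2⟩, fun h => ⟨universalGroup_le_G le_rfl h.1, h.2⟩⟩

/-- Fixing both ends of each boundary edge makes the glued map coincide with a single `u i`, or with
the identity, on the whole star of every vertex. The family may be infinite. -/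
theorem exists_mem_universalGroup_glue {ι : Type*}
    (B : ι → Set V) (hB : ∀ i j z, z ∈ B i → z ∈ B j → i = j) (u : ι → T ≃g T)
    (hu : ∀ i z, u i z ∈ B i ↔ z ∈ B i)
    (hb : ∀ i z z', T.Adj z z' → z ∈ B i → z' ∉ B i → u i z = z ∧ u i z' = z')
    (huF : ∀ i, u i ∈ c.universalGroup F) :
    ∃ g ∈ c.universalGroup F, (∀ i, ∀ z ∈ B i, g z = u i z) ∧ ∀ z, (∀ i, z ∉ B i) → g z = z := by
  obtain ⟨g, hg1, hg2⟩ := SimpleGraph.exists_iso_glue B hB u hu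
    fun i z z' h hz hz' => (hb i z z' h hz hz').1
  have hfix : ∀ z z', T.Adj z z' → (∀ i, z ∈ B i → z' ∉ B i) → g z = z := by
    intro z z' h hn
    by_cases hz : ∃ i, z ∈ B i
    · obtain ⟨i, hi⟩ := hz
      rw [hg1 i z hi, (hb i z z' h hi (hn i hi)).1]
    · exact hg2 z (not_exists.1 hz)
  refine ⟨g, fun z => ?_, hg1, hg2⟩
  by_cases hz : ∃ i, z ∈ B i
  · obtain ⟨i, hi⟩ := hz
    rw [c.localPerm_congr (h := u i) (hg1 i z hi) fun a => ?_]
    · exact huF i z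
    · by_cases ha : c.nb z a ∈ B i
      · exact hg1 i _ ha
      · rw [(hb i z _ (c.adj_nb z a) hi ha).2]
        exact hfix _ z (c.adj_nb z a).symm fun j hj hj' => ha (by rwa [hB i j z hi hj'])
  · rw [c.localPerm_congr (h := 1) (hg2 z (not_exists.1 hz)) fun a => ?_, localPerm_one]
    · exact F.one_mem
    · exact hfix _ z (c.adj_nb z a).symm fun j _ hj' => hz ⟨j, hj'⟩

theorem eq_nb_of_adj_of_notMem_half (hT : T.IsTree) {x z z' : V} {e : Ω} (h : T.Adj z z')
    (hz : z ∈ c.half x e) (hz' : z' ∉ c.half x e) : z = c.nb x e ∧ z' = x := by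
  obtain ⟨b, rfl⟩ := c.exists_nb_eq h
  by_contra hne
  refine hz' (c.nb_mem_half_of_mem hT hz ?_)
  rintro ⟨rfl, rfl⟩
  exact hne ⟨rfl, c.nb_nb _ _⟩

theorem fixes_nb_of_supported (hT : T.IsTree) {u : T ≃g T} {x : V} {e : Ω}
    (hu : ∀ y, y ∉ c.half x e → u y = y) : u (c.nb x e) = c.nb x e := by
  by_cases h : u (c.nb x e) ∈ c.half x e
  · have hx := hu x (c.notMem_half_self hT x e)
    have hadj : T.Adj (u (c.nb x e)) x := by
      have := u.map_adj_iff.2 (c.adj_nb x e)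
      rw [hx] at this
      exact this.symm
    exact (c.eq_nb_of_adj_of_notMem_half hT hadj h (c.notMem_half_self hT x e)).1
  · exact u.injective (hu _ h)

/-- An element supported in a half-tree whose images under the positive powers of `q` are disjoint
from it is a commutator with `q`. -/
theorem exists_eq_commutator (hT : T.IsTree) {u q : T ≃g T}
    (huF : u ∈ c.universalGroup F) (hqF : q ∈ c.universalGroup F) {x : V} {e : Ω}
    (hu : ∀ y, y ∉ c.half x e → u y = y)
    (hq : ∀ n : ℕ, ∀ y ∈ c.half x e, (q ^ (n + 1)) y ∉ c.half x e) :
    ∃ k ∈ typePreserving (c.universalGroup F), u = k * q * k⁻¹ * q⁻¹ := by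
  have huB : ∀ y, u y ∈ c.half x e ↔ y ∈ c.half x e := by
    intro y
    refine ⟨fun h => ?_, fun h => ?_⟩
    · by_contra hy
      rw [hu y hy] at h
      exact hy h
    · by_contra hy
      have := u.injective (hu _ hy)
      rw [this] at hy
      exact hy h
  have hlt : ∀ m n : ℕ, m < n → ∀ z, (q ^ m)⁻¹ z ∈ c.half x e → (q ^ n)⁻¹ z ∉ c.half x e := by
    intro m n hmn z hm hn
    obtain ⟨d, rfl⟩ := Nat.exists_eq_add_of_lt hmn
    refine hq d _ hn ?_
    have : q ^ (d + 1) * (q ^ (m + d + 1))⁻¹ = (q ^ m)⁻¹ := by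
      rw [mul_inv_eq_iff_eq_mul, eq_inv_mul_iff_mul_eq, ← pow_add, add_assoc]
    rwa [← RelIso.mul_apply, this]
  -- `k` is the infinite product over n ≥ 0 of qⁿ u q⁻ⁿ, supported on the disjoint sets qⁿ(`half x
  -- e`).
  obtain ⟨k, hkF, hk1, hk2⟩ := c.exists_mem_universalGroup_glue (F := F)
    (fun n : ℕ => {z | (q ^ n)⁻¹ z ∈ c.half x e})
    (fun m n z hm hn => by
      rcases lt_trichotomy m n with h | h | h
      · exact absurd hn (hlt m n h z hm)
      · exact h
      · exact absurd hm (hlt n m h z hn))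
    (fun n => q ^ n * u * (q ^ n)⁻¹)
    (fun n z => by
      simp only [Set.mem_ofPred_eq, RelIso.mul_apply, RelIso.inv_apply_self]
      exact huB _)
    (fun n z z' h hz hz' => by
      have hadj : T.Adj ((q ^ n)⁻¹ z) ((q ^ n)⁻¹ z') := ((q ^ n)⁻¹ : T ≃g T).map_adj_iff.2 h
      obtain ⟨h1, h2⟩ := c.eq_nb_of_adj_of_notMem_half hT hadj hz hz'
      simp only [RelIso.mul_apply, h1, h2, c.fixes_nb_of_supported hT hu,
        hu x (c.notMem_half_self hT x e)]
      rw [← h1, ← h2]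
      simp)
    (fun n => mul_mem (mul_mem (pow_mem hqF n) huF) (inv_mem (pow_mem hqF n)))
  simp only [Set.mem_ofPred_eq] at hk1 hk2
  refine ⟨k, c.mem_typePreserving_of_fixed hT (v := c.nb x e) hkF ?_, ?_⟩
  · rw [hk1 0 _ (by simpa using c.nb_mem_half x e)]
    simpa using c.fixes_nb_of_supported hT hu
  -- Conjugation by `q` shifts the product by one, so only the factor n = 0, namely `u`, is missing.
  suffices h : u * (q * k * q⁻¹) = k by
    rw [eq_mul_inv_of_mul_eq h]
    simp [mul_assoc]
  refine RelIso.ext fun z => ?_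
  simp only [RelIso.mul_apply]
  have hpow : ∀ n : ℕ, (q ^ n)⁻¹ (q⁻¹ z) = (q ^ (n + 1))⁻¹ z := fun n => by
    rw [← RelIso.mul_apply, ← mul_inv_rev, ← pow_succ']
  by_cases hn : ∃ n : ℕ, (q ^ (n + 1))⁻¹ z ∈ c.half x e
  · obtain ⟨n, hn⟩ := hn
    have hz : k z ∉ c.half x e := by
      rw [hk1 (n + 1) z hn]
      simp only [RelIso.mul_apply]
      exact hq n _ ((huB _).2 hn)
    have hkq : q (k (q⁻¹ z)) = k z := by
      rw [hk1 n _ (by rwa [hpow]), hk1 (n + 1) z hn]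
      simp only [RelIso.mul_apply, hpow]
      rw [← RelIso.mul_apply, ← pow_succ']
    rw [hkq, hu _ hz]
  · push Not at hn
    have hkq : q (k (q⁻¹ z)) = z := by
      rw [hk2 _ fun n => by rw [hpow]; exact hn n, RelIso.apply_inv_self]
    rw [hkq]
    by_cases hz : z ∈ c.half x e
    · rw [hk1 0 z (by simpa using hz)]
      simp
    · rw [hu z hz, hk2 z fun n => ?_]
      cases n with
      | zero => simpa using hz
      | succ n => exact hn n

/-- Ping-pong: two conjugates of an element of `P` push the complements of `half v a` and `half v'
a` into these sets, which lie in distinct branches at `x` other than `half x e`. Every positive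
power of their product sends `half x e` into `half v' a`. -/
theorem exists_displacing [Finite Ω] (hΩ : 3 ≤ Nat.card Ω) (hT : T.IsTree) {P : Subgroup (T ≃g T)}
    (hne : P ≠ ⊥)
    (hconj : ∀ h ∈ typePreserving (c.universalGroup ⊥), ∀ p ∈ P, h * p * h⁻¹ ∈ P) (x : V) (e : Ω) :
    ∃ q ∈ P, ∀ n : ℕ, ∀ y ∈ c.half x e, (q ^ (n + 1)) y ∉ c.half x e := by
  obtain ⟨p, hp, hp1⟩ := P.ne_bot_iff_exists_ne_one.1 hne |>.elim fun p h =>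
    (⟨p, p.2, fun h' => h (Subtype.ext h')⟩ : ∃ p, p ∈ P ∧ p ≠ 1)
  obtain ⟨y, a, hy⟩ := c.exists_half_disjoint_image hΩ hT hp1
  obtain ⟨b, hbe, -⟩ := exists_ne_and_ne_of_three_le_card hΩ e e
  obtain ⟨d, hde, hdb⟩ := exists_ne_and_ne_of_three_le_card hΩ e b
  obtain ⟨v, hvb, -, hv⟩ := c.exists_half_subset hΩ hT x b Set.finite_empty (c.nb y a) a
  obtain ⟨v', hvd, -, hv'⟩ := c.exists_half_subset hΩ hT x d Set.finite_empty v a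
  obtain ⟨h, hh, hhv⟩ := c.exists_mem_universalGroup_bot hT (c.nb y a) v
  obtain ⟨g, hg, hgv⟩ := c.exists_mem_universalGroup_bot hT v v'
  have hhT : h ∈ typePreserving (c.universalGroup ⊥) :=
    (c.mem_typePreserving_iff hT _).2 ⟨hh, by rwa [hhv]⟩
  have hgT : g ∈ typePreserving (c.universalGroup ⊥) :=
    (c.mem_typePreserving_iff hT _).2 ⟨hg, by rwa [hgv]⟩
  have hp' : ∀ z, z ∉ c.half v a → (h * p * h⁻¹) z ∈ c.half v a := by
    intro z hz
    have hmap : ∀ z, h z ∈ c.half v a ↔ z ∉ c.half y a := fun z => by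
      have := c.map_mem_half hT h (v := c.nb y a) (x := z) (a := a)
      rwa [localPerm_eq_one_of_mem hh, hhv, Equiv.Perm.one_apply, c.mem_half_nb hT] at this
    rw [RelIso.mul_apply, RelIso.mul_apply, hmap]
    refine hy _ ?_
    have := (hmap (h⁻¹ z)).not
    rw [RelIso.apply_inv_self, not_not] at this
    exact this.1 hz
  have hp'' : ∀ z, z ∉ c.half v' a → (g * (h * p * h⁻¹) * g⁻¹) z ∈ c.half v' a := by
    intro z hz
    have hmap : ∀ z, g z ∈ c.half v' a ↔ z ∈ c.half v a := fun z => by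
      have := c.map_mem_half hT g (v := v) (x := z) (a := a)
      rwa [localPerm_eq_one_of_mem hg, hgv, Equiv.Perm.one_apply] at this
    rw [RelIso.mul_apply, RelIso.mul_apply, hmap]
    refine hp' _ ?_
    rwa [← hmap, RelIso.apply_inv_self]
  have hP1 := hconj h hhT p hp
  refine ⟨_, mul_mem (hconj g hgT _ hP1) hP1, fun n z hz => ?_⟩
  have hstep : ∀ z, z ∉ c.half v a →
      (g * (h * p * h⁻¹) * g⁻¹ * (h * p * h⁻¹)) z ∈ c.half v' a := fun z hz => by
    rw [RelIso.mul_apply]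
    exact hp'' _ fun hmem => Set.disjoint_left.1 (c.disjoint_half hT x hdb) (hvd hmem)
      (hvb (hp' z hz))
  have hpow : ((g * (h * p * h⁻¹) * g⁻¹ * (h * p * h⁻¹)) ^ (n + 1)) z ∈ c.half v' a := by
    induction n with
    | zero =>
      rw [zero_add, pow_one]
      exact hstep z fun hmem => Set.disjoint_left.1 (c.disjoint_half hT x hbe) (hvb hmem) hz
    | succ n ih =>
      rw [pow_succ', RelIso.mul_apply]
      exact hstep _ fun hmem => Set.disjoint_left.1 (c.disjoint_half hT x hdb) (hvd ih) (hvb hmem)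
  exact Set.disjoint_left.1 (c.disjoint_half hT x hde) (hvd hpow)

end LegalColoring

namespace LegalColoring

variable {V : Type u} {T : SimpleGraph V} {Ω : Type w} (c : LegalColoring T Ω)
variable {F : Subgroup (Equiv.Perm Ω)}

/-! ### Simplicity of the type-preserving subgroup of `U(F)` -/

/-- A subgroup containing the elements of `U(F)` supported in half-trees contains the edge fixators
of `U(F)`. -/
theorem mem_of_fixes_edge (hT : T.IsTree) {P : Subgroup (T ≃g T)}
    (hP : ∀ x e, ∀ u ∈ c.universalGroup F, (∀ y, y ∉ c.half x e → u y = y) → u ∈ P)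
    {u : T ≃g T} (hu : u ∈ c.universalGroup F) {v : V} {a : Ω} (hv : u v = v)
    (ha : u (c.nb v a) = c.nb v a) : u ∈ P := by
  have hs : c.localPerm u v a = a := by
    rw [map_nb, hv] at ha
    exact c.nb_injective v ha
  -- Split `u` along the fixed edge: `k` is `u` on one side and trivial on the other, so `k⁻¹ * u`
  -- is supported in the opposite half-tree.
  obtain ⟨k, hkF, hk1, hk2⟩ := c.exists_mem_universalGroup_glue (F := F)
    (fun _ : Unit => c.half v a) (fun _ _ _ _ _ => rfl) (fun _ => u)
    (fun _ z => by
      have := c.map_mem_half hT u (v := v) (x := z) (a := a)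
      rwa [hv, hs] at this)
    (fun _ z z' h hz hz' => by
      obtain ⟨rfl, rfl⟩ := c.eq_nb_of_adj_of_notMem_half hT h hz hz'
      exact ⟨ha, hv⟩) (fun _ => hu)
  have hkP : k ∈ P := hP v a k hkF fun y hy => hk2 y fun _ => hy
  have h2 : k⁻¹ * u ∈ P := by
    refine hP (c.nb v a) a _ (mul_mem (inv_mem hkF) hu) fun y hy => ?_
    rw [c.mem_half_nb hT, not_not] at hy
    rw [RelIso.mul_apply, ← hk1 () y hy, RelIso.inv_apply_self]
  simpa using mul_mem hkP h2

/-- If `F` is transitive and generated by its point stabilizers, then the type-preserving subgroup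
of `U(F)` is generated by the edge fixators. -/
theorem typePreserving_universalGroup_le_of_edge [Nonempty Ω] (hT : T.IsTree)
    [MulAction.IsPretransitive F Ω] (hgen : stabilizerGenerated F = F) {P : Subgroup (T ≃g T)}
    (hPF : P ≤ c.universalGroup F)
    (hP : ∀ u ∈ c.universalGroup F, ∀ v a, u v = v → u (c.nb v a) = c.nb v a → u ∈ P) :
    typePreserving (c.universalGroup F) ≤ P := by
  -- A permutation fixing a color is realized by an edge-fixing automorphism with constant local
  -- permutation; `hgen` extends this to all of `F`.
  have hloc : ∀ v, ∀ f ∈ F, ∃ p ∈ P, p v = v ∧ c.localPerm p v = f := by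
    intro v
    let K : Subgroup (Equiv.Perm Ω) :=
      { carrier := {f | ∃ p ∈ P, p v = v ∧ c.localPerm p v = f}
        one_mem' := ⟨1, P.one_mem, rfl, c.localPerm_one v⟩
        mul_mem' := by
          rintro _ _ ⟨p, hp, hpv, rfl⟩ ⟨p', hp', hpv', rfl⟩
          refine ⟨p * p', mul_mem hp hp', by rw [RelIso.mul_apply, hpv', hpv], ?_⟩
          rw [localPerm_mul, hpv']
        inv_mem' := by
          rintro _ ⟨p, hp, hpv, rfl⟩
          have hinv : p⁻¹ v = v := by
            conv_lhs => rw [← hpv]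
            exact RelIso.inv_apply_self _ _
          exact ⟨p⁻¹, inv_mem hp, hinv, by rw [localPerm_inv, hinv]⟩ }
    suffices h : stabilizerGenerated F ≤ K by rwa [hgen] at h
    refine iSup_le fun a f hf => ?_
    obtain ⟨g, hgv, hg⟩ := c.exists_localPerm_eq hT (fun _ => f) (fun _ _ => rfl) v v
    refine ⟨g, hP g (fun y => by rw [hg]; exact hf.1) v a hgv ?_, hgv, hg v⟩
    have hfa : f a = a := hf.2
    rw [map_nb, hgv, hg, hfa]
  obtain ⟨v⟩ := hT.connected.nonempty
  -- `P` is transitive on the block of `v`: rotating about an odd vertex by an element of `P`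
  -- carries one of its neighbours to any other.
  have htrans : ∀ x, (Even (T.dist v x) → ∃ p ∈ P, p v = x) ∧
      (¬ Even (T.dist v x) → ∃ p ∈ P, ∃ a, x = c.nb (p v) a) := by
    refine c.nb_induction hT (P := fun x => (Even (T.dist v x) → ∃ p ∈ P, p v = x) ∧
      (¬ Even (T.dist v x) → ∃ p ∈ P, ∃ a, x = c.nb (p v) a)) v ?_ fun x b ih => ?_
    · exact ⟨fun _ => ⟨1, P.one_mem, rfl⟩, fun h => absurd (by simp) h⟩
    · rw [even_dist_nb c hT, not_not]
      refine ⟨fun h => ?_, fun h => ?_⟩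
      · obtain ⟨p, hp, a, hxa⟩ := ih.2 h
        obtain ⟨f, hf⟩ := MulAction.exists_smul_eq F a b
        obtain ⟨p', hp', hpx, hpf⟩ := hloc x f f.2
        refine ⟨p' * p, mul_mem hp' hp, ?_⟩
        have hpv : p v = c.nb x a := by rw [hxa, nb_nb]
        rw [RelIso.mul_apply, hpv, map_nb, hpx, hpf]
        exact congrArg _ hf
      · obtain ⟨p, hp, hpx⟩ := ih.1 h
        exact ⟨p, hp, b, by rw [hpx]⟩
  intro g hg
  obtain ⟨p, hp, hpg⟩ := (htrans (g v)).1 ((c.mem_typePreserving_iff hT v).1 hg).2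
  have hfix : (p⁻¹ * g) v = v := by
    rw [RelIso.mul_apply, ← hpg, RelIso.inv_apply_self]
  have hF : p⁻¹ * g ∈ c.universalGroup F := mul_mem (inv_mem (hPF hp)) hg.1
  -- `p'` corrects the local permutation at `v`, so that the remaining factor fixes an edge.
  obtain ⟨p', hp', hpv', hpl'⟩ := hloc v _ (hF v)
  have hinv : p'⁻¹ v = v := by
    conv_lhs => rw [← hpv']
    exact RelIso.inv_apply_self _ _
  obtain ⟨a⟩ := ‹Nonempty Ω›
  have hmem : p'⁻¹ * (p⁻¹ * g) ∈ P := by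
    refine hP _ (mul_mem (inv_mem (hPF hp')) hF) v a ?_ ?_
    · rw [RelIso.mul_apply, hfix, hinv]
    · rw [RelIso.mul_apply, map_nb, hfix, ← hpl', map_nb, hinv, localPerm_inv, hinv]
      simp
  have := mul_mem hp (mul_mem hp' hmem)
  simpa using this

/-- A nontrivial normal subgroup contains, with `q`, each commutator `k * q * k⁻¹ * q⁻¹`, hence
every element supported in a half-tree, hence the edge fixators. -/
theorem isSimpleGroup_typePreserving_universalGroup [Finite Ω] (hΩ : 3 ≤ Nat.card Ω) (hT : T.IsTree)
    [MulAction.IsPretransitive F Ω] (hgen : stabilizerGenerated F = F) :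
    IsSimpleGroup (typePreserving (c.universalGroup F)) := by
  have hne : Nonempty Ω := by
    by_contra h
    rw [not_nonempty_iff] at h
    simp at hΩ
  refine Subgroup.isSimpleGroup_of_forall_le ?_ fun P hP hconj hPne => ?_
  · obtain ⟨v⟩ := hT.connected.nonempty
    obtain ⟨a⟩ := hne
    obtain ⟨b, hba, -⟩ := exists_ne_and_ne_of_three_le_card hΩ a a
    obtain ⟨k, hk, hkv⟩ := c.exists_mem_universalGroup_bot hT v (c.nb (c.nb v a) b)
    have hkT : k ∈ typePreserving (c.universalGroup F) :=
      (c.mem_typePreserving_iff hT v).2 ⟨universalGroup_mono bot_le hk, by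
        rw [hkv, even_dist_nb c hT, even_dist_nb c hT]; simp⟩
    intro hbot
    rw [hbot, Subgroup.mem_bot] at hkT
    rw [hkT] at hkv
    have h : c.nb (c.nb v a) a = c.nb (c.nb v a) b := (c.nb_nb v a).trans hkv
    exact hba (c.nb_injective _ h).symm
  · refine c.typePreserving_universalGroup_le_of_edge hT hgen (fun p hp => (hP hp).1) ?_
    intro u hu v a hv ha
    refine c.mem_of_fixes_edge hT ?_ hu hv ha
    intro x e u hu hout
    obtain ⟨q, hq, hdisp⟩ := c.exists_displacing hΩ hT hPne (fun h hh p hp =>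
      hconj h (typePreserving_mono (universalGroup_mono bot_le) hh) p hp) x e
    obtain ⟨k, hk, rfl⟩ := c.exists_eq_commutator hT hu (hP hq).1 hout hdisp
    exact mul_mem (hconj k hk q hq) (inv_mem hq)

end LegalColoring

theorem youngSubgroup_eq_top {Ω : Type w} {F : Subgroup (Equiv.Perm Ω)}
    [MulAction.IsPretransitive F Ω] : youngSubgroup F = ⊤ :=
  eq_top_iff.2 fun s _ a => MulAction.exists_smul_eq F a (s a)

theorem mainTheorem2 {V : Type u} {Ω : Type w} [Finite Ω] (hΩ : 3 ≤ Nat.card Ω)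
    (T : SimpleGraph V) (hT : T.IsTree) (c : LegalColoring T Ω) :
    (∀ F F'' F' : Subgroup (Equiv.Perm Ω), F ≤ F'' → F'' ≤ F' → F' ≤ youngSubgroup F →
      F''.relIndex F' = 2 → IsSimpleGroup (typePreserving (c.G F F'')) →
      c.N F F' ≤ c.G F F' ∧ IsSimpleGroup (c.N F F') ∧ (c.N F F').relIndex (c.G F F') = 8) ∧
    (∀ F F' : Subgroup (Equiv.Perm Ω), F ≤ F' → ∀ hF : F.relIndex F' = 2,
      MulAction.IsPretransitive F Ω → stabilizerGenerated F = F →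
      ∀ v₀ v₁ : V, T.Adj v₀ v₁ →
        c.evenGroup F F' hF v₀ ⊓ c.evenGroup F F' hF v₁ ≤ c.G F F' ∧
        IsSimpleGroup (c.evenGroup F F' hF v₀ ⊓ c.evenGroup F F' hF v₁ : Subgroup (T ≃g T)) ∧
        (c.evenGroup F F' hF v₀ ⊓ c.evenGroup F F' hF v₁).relIndex (c.G F F') = 8) := by
  constructor
  · intro F F'' F' h1 h2 hY hi hs
    obtain ⟨v⟩ := hT.connected.nonempty
    obtain ⟨a⟩ : Nonempty Ω := by
      by_contra h
      rw [not_nonempty_iff] at h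
      simp at hΩ
    have hv := c.adj_nb v a
    rw [c.N_eq_evenPart hΩ hT h1 h2 hY hi hv]
    exact ⟨inf_le_right, c.isSimpleGroup_evenPart hΩ hT h1 h2 hY hi hv,
      c.relIndex_evenPart hΩ hT h1 h2 hY hi hv⟩
  · intro F F' h hi htrans hgen v₀ v₁ hv
    -- For F'' = F the extra intersection with G(F, F') in `evenPart` changes nothing.
    have heq : c.evenGroup F F' hi v₀ ⊓ c.evenGroup F F' hi v₁ = c.evenPart F hi v₀ v₁ :=
      (inf_eq_left.2 fun _ hg => hg.1.1.1).symm
    have hs : IsSimpleGroup (typePreserving (c.G F F)) := by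
      rw [show typePreserving (c.G F F) = typePreserving (c.universalGroup F) from
        Subgroup.ext fun _ => c.mem_typePreserving_G_self]
      exact c.isSimpleGroup_typePreserving_universalGroup hΩ hT hgen
    have hY : F' ≤ youngSubgroup F := youngSubgroup_eq_top (F := F) ▸ le_top
    rw [heq]
    exact ⟨inf_le_right, c.isSimpleGroup_evenPart hΩ hT le_rfl h hY hi hv,
      c.relIndex_evenPart hΩ hT le_rfl h hY hi hv⟩
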